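/- Let $n\ge 1$ and $\kappa=(\kappa_1,\kappa_2)\in\mathbb{C}^2$. Let $\hat{\mathcal H}_n^{\kappa}$ be the cyclotomic degenerate affine Hecke algebra, that is, the unital associative $\mathbb{C}$-algebra generated by $x_1,\dots,x_n,s_1,\dots,s_{n-1}$ with relations $(x_1-\kappa_1)(x_1-\kappa_2)=0$; $x_rs_\ell=s_\ell x_r$ for $r\ne \ell,\ell+1$; $x_rx_t=x_tx_r$; $x_{r+1}=s_rx_rs_r+s_r$; $s_k^2=1$; $s_is_j=s_js_i$ for $|i-j|>1$; $s_ks_{k+1}s_k=s_{k+1}s_ks_{k+1}$. Let $\mathcal A_n^{\kappa}$ be its quotient by the relation (imposed when $n\ge 2$) $$(x_1s_1)^2=\kappa_1(1+\kappa_1)(s_1-1)+\kappa_1(s_1x_1s_1-s_1x_1)+(1+\kappa_1)(x_1-x_1s_1)+x_1s_1x_1 .$$ Let $B_n$ be the group of signed permutations, i.e. permutations $\omega$ of $\{\pm1,\dots,\pm n\}$ with $\omega(-j)=-\omega(j)$, and write $\tau_0=(1\ {-1})$, $\tau_i=(i\ \ i{+}1)(-i\ \ {-}(i{+}1))$ for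 $1\le i\le n-1$. Every $\omega\in B_n$ is uniquely a product $\omega=f_0f_1\cdots f_{n-1}$ with $$f_m\in\{1,\ \tau_m,\ \tau_m\tau_{m-1},\ \dots,\ \tau_m\cdots\tau_1\tau_0,\ \tau_m\cdots\tau_1\tau_0\tau_1,\ \dots,\ \tau_m\cdots\tau_1\tau_0\tau_1\cdots\tau_m\}.$$ Let $s_\omega\in\hat{\mathcal H}_n^{\kappa}$ be obtained from this expression by replacing $\tau_0$ by $x_1$ and $\tau_i$ by $s_i$ for $i\ge1$, and put $m_i(\omega)=1$ if $\tau_0$ occurs in $f_i$ and $m_i(\omega)=0$ otherwise. Let $B_n(\bar1\bar2)$ be the set of $\omega\in B_n$ such that $|\omega(i)|>|\omega(j)|$ whenever $1\le i<j\le n$ and $\omega(i),\omega(j)<0$. Set $$\tilde F_n^{(1,\kappa_1)}=\sum_{\omega\in B_n}\Big(\prod_{i=0}^{n-1}(i-\kappa_2)^{1-m_i(\omega)}\Big)s_\omega,\qquad \Delta_{n-1}=x_1\cdot(s_1x_1)\cdot(s_2s_1x_1)\cdots(s_{n-1}\cdots s_1x_1),$$ with the convention $0^0=1$. Then the images of the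 $s_\omega$, $\omega\in B_n(\bar1\bar2)$, form a basis of $\mathcal A_n^{\kappa}$; the image of $\Delta_{n-1}$ is one of these basis elements; and when the image of $\tilde F_n^{(1,\kappa_1)}$ in $\mathcal A_n^{\kappa}$ is expanded in this basis, $\Delta_{n-1}$ appears with coefficient $n!$. -/

import Mathlib

open scoped Nat

namespace FusedHecke

/-! ### Signed permutations -/

/-- The set `{-n, …, -1, 1, …, n}`. -/
abbrev SignedSet (n : ℕ) : Type := {j : ℤ // j ≠ 0 ∧ |j| ≤ n}

instance (n : ℕ) : Finite (SignedSet n) :=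
  Set.Finite.subset (Set.finite_Icc (-(n : ℤ)) n) (fun _ hj => abs_le.mp hj.2)

instance (n : ℕ) : Neg (SignedSet n) :=
  ⟨fun j => ⟨-j.1, neg_ne_zero.mpr j.2.1, by rw [abs_neg]; exact j.2.2⟩⟩

@[simp] theorem SignedSet.coe_neg {n : ℕ} (j : SignedSet n) : (-j).1 = -j.1 := rfl

/-- The element `i + 1` of `{-n, …, -1, 1, …, n}`, for `0 ≤ i < n`. -/
def pos {n : ℕ} (i : Fin n) : SignedSet n :=
  ⟨(i : ℤ) + 1, by omega, by
    have := i.2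
    rw [abs_le]; constructor <;> omega⟩

/-- The Coxeter group `B_n` of signed permutations: the permutations `ω` of
`{-n, …, -1, 1, …, n}` such that `ω (-j) = -ω j`. The product is composition of maps. -/
def SignedPerm (n : ℕ) : Subgroup (Equiv.Perm (SignedSet n)) where
  carrier := {ω | ∀ j, ω (-j) = -ω j}
  mul_mem' := by
    intro a b ha hb j
    simp only [Set.mem_ofPred_eq, Equiv.Perm.coe_mul, Function.comp_apply] at *
    rw [hb, ha]
  one_mem' := fun _ => rfl
  inv_mem' := by
    intro a ha j
    rw [Equiv.Perm.inv_eq_iff_eq, ha]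
    exact congrArg _ (a.apply_symm_apply j).symm

instance (n : ℕ) : Finite (SignedPerm n) := inferInstanceAs (Finite {_ω // _})

noncomputable instance (n : ℕ) : Fintype (SignedPerm n) := Fintype.ofFinite _

/-- The underlying map of the generator `τ_i`: `τ_0` exchanges `1` and `-1`; for `i ≥ 1`, `τ_i`
exchanges `i` and `i + 1`, and also `-i` and `-(i + 1)`. -/
def tauFun (i : ℕ) (j : ℤ) : ℤ :=
  if i = 0 then (if |j| = 1 then -j else j)
  else if j = i then i + 1
  else if j = i + 1 then i
  else if j = -i then -(i + 1)
  else if j = -(i + 1) then -i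
  else j

theorem tauFun_tauFun (i : ℕ) (j : ℤ) : tauFun i (tauFun i j) = j := by
  unfold tauFun; grind

theorem tauFun_neg (i : ℕ) (j : ℤ) : tauFun i (-j) = -tauFun i j := by
  unfold tauFun; grind

theorem tauFun_ne_zero (i : ℕ) (j : ℤ) (hj : j ≠ 0) : tauFun i j ≠ 0 := by
  unfold tauFun; grind

theorem tauFun_abs_le {n i : ℕ} (hi : i < n) {j : ℤ} (hj : |j| ≤ n) : |tauFun i j| ≤ n := by
  unfold tauFun; grind

/-- The generators `τ_0, τ_1, …, τ_{n-1}` of `B_n`. -/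
def tau {n : ℕ} (i : Fin n) : SignedPerm n :=
  ⟨Function.Involutive.toPerm
      (fun j : SignedSet n =>
        (⟨tauFun i j.1, tauFun_ne_zero i j.1 j.2.1, tauFun_abs_le i.2 j.2.2⟩ : SignedSet n))
      (fun j => Subtype.ext (tauFun_tauFun i j.1)),
    fun j => Subtype.ext (tauFun_neg i j.1)⟩

/-- `ω` avoids `1̄2̄`: in the word `b_1 … b_n` of `ω`, where `b_i = ω(i)` and a negative value is a
barred number, the barred numbers appear in decreasing order (of the numbers under the bars). -/
def Avoids {n : ℕ} (ω : SignedPerm n) : Prop :=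
  ∀ i j : Fin n, i < j → (ω.1 (pos i)).1 < 0 → (ω.1 (pos j)).1 < 0 →
    |(ω.1 (pos j)).1| < |(ω.1 (pos i)).1|

/-! ### Words and normal forms

In a monoid with elements `g 0, …, g (n-1)`, we form the products that occur in the normal form
of signed permutations. They are used with `g = τ` and with `g = (x_1, s_1, …, s_{n-1})`. -/

section Words

variable {M : Type*} [Monoid M] {n : ℕ}

/-- The product `g_m g_{m-1} ⋯ g_a` (equal to `1` when `a = m + 1`). -/
def desc (g : Fin n → M) (m : Fin n) (a : ℕ) : M :=
  (List.ofFn fun t : Fin (m + 1 - a) => g ⟨m - t, by omega⟩).prod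

/-- The product `g_1 g_2 ⋯ g_j`, for `j ≤ m`. -/
def asc (g : Fin n → M) (m : Fin n) (j : Fin (m + 1)) : M :=
  (List.ofFn fun t : Fin j => g ⟨t + 1, by omega⟩).prod

/-- The elements of the `m`-th set of the normal form:
`{1, g_m, g_m g_{m-1}, …, g_m ⋯ g_1, g_m ⋯ g_1 g_0, g_m ⋯ g_1 g_0 g_1, …, g_m ⋯ g_0 ⋯ g_m}`.
For `0 ≤ j ≤ m`, the label `(false, j)` stands for `g_m ⋯ g_{j+1}` (without `g_0`) and the label
`(true, j)` for `g_m ⋯ g_1 g_0 g_1 ⋯ g_j` (with `g_0`). -/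
def factor (g : Fin n → M) (m : Fin n) (c : Bool × Fin (m + 1)) : M :=
  if c.1 then desc g m 0 * asc g m c.2 else desc g m (c.2 + 1)

/-- A choice of one element in each of the sets number `0, 1, …, n-1` of the normal form. -/
abbrev NormalForm (n : ℕ) : Type := (m : Fin n) → Bool × Fin (m + 1)

/-- The product of the chosen elements of the sets number `0, 1, …, k-1`, in this order. -/
def partialProd (g : Fin n → M) (c : NormalForm n) : (k : ℕ) → k ≤ n → M
  | 0, _ => 1
  | k + 1, h => partialProd g c k (Nat.le_of_succ_le h) * factor g ⟨k, h⟩ (c ⟨k, h⟩)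

/-- The product of the chosen elements of the sets number `0, 1, …, n-1`, in this order. -/
def normalProd (g : Fin n → M) (c : NormalForm n) : M := partialProd g c n le_rfl

end Words

/-! The products of the `τ_i` in normal form are the elements of `B_n`, each obtained once. -/

section Bijective

variable {n : ℕ}

/-- The integer `j + 1` or `-(j + 1)`. -/
def spot (b : Bool) (j : ℕ) : ℤ := if b then -((j : ℤ) + 1) else (j : ℤ) + 1

theorem tau_val (i : Fin n) (j : SignedSet n) : ((tau i).1 j).1 = tauFun i j.1 := rfl

/-- The signed permutations which fix `j` for all `|j| > k`. -/
def fixing (n k : ℕ) : Subgroup (SignedPerm n) where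
  carrier := {ω | ∀ j : SignedSet n, (k : ℤ) < |j.1| → ω.1 j = j}
  mul_mem' := by
    intro a b ha hb j hj
    change a.1 (b.1 j) = j
    rw [hb j hj, ha j hj]
  one_mem' := fun _ _ => rfl
  inv_mem' := by
    intro a ha j hj
    change (a.1)⁻¹ j = j
    rw [Equiv.Perm.inv_eq_iff_eq, ha j hj]

theorem fixing_mono {k l : ℕ} (h : k ≤ l) : fixing n k ≤ fixing n l :=
  fun _ hω j hj => hω j (by omega)

theorem tau_mem_fixing (i : Fin n) (k : ℕ) (h : (i : ℕ) < k) : tau i ∈ fixing n k := by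
  intro j hj
  apply Subtype.ext
  rw [tau_val]
  unfold tauFun; grind

theorem desc_mem (m : Fin n) (a : ℕ) : desc tau m a ∈ fixing n (m + 1) := by
  apply Subgroup.list_prod_mem
  intro x hx
  obtain ⟨t, rfl⟩ := (List.mem_ofFn' _ _).mp hx
  exact tau_mem_fixing _ _ (by change (m : ℕ) - t < m + 1; omega)

theorem asc_mem (m : Fin n) (j : Fin (m + 1)) : asc tau m j ∈ fixing n (m + 1) := by
  apply Subgroup.list_prod_mem
  intro x hx
  obtain ⟨t, rfl⟩ := (List.mem_ofFn' _ _).mp hx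
  exact tau_mem_fixing _ _ (by have := t.2; have := j.2; change (t : ℕ) + 1 < m + 1; omega)

theorem factor_mem (m : Fin n) (c : Bool × Fin (m + 1)) : factor tau m c ∈ fixing n (m + 1) := by
  unfold factor
  split
  · exact mul_mem (desc_mem _ _) (asc_mem _ _)
  · exact desc_mem _ _

theorem desc_apply (m : Fin n) (l : ℕ) (hl : l ≤ m) (j : SignedSet n)
    (hj : j.1 = (m : ℤ) + 1 - l) :
    (((List.ofFn fun t : Fin l => tau (⟨m - t, by omega⟩ : Fin n)).prod).1 j).1 = (m : ℤ) + 1 := by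
  induction l generalizing j with
  | zero => simpa using hj
  | succ l ih =>
    rw [List.ofFn_succ', List.concat_eq_append, List.prod_append, List.prod_singleton]
    refine ih (by omega) ((tau (⟨m - l, by omega⟩ : Fin n)).1 j) ?_
    have h1 : (((m : ℕ) - l : ℕ) : ℤ) = (m : ℤ) - l := by omega
    have h2 : j.1 = (m : ℤ) - l := by push_cast at hj; omega
    have h3 : (m : ℕ) - l ≠ 0 := by omega
    rw [tau_val]
    simp only [tauFun, h1, h2, h3, if_true, if_false]
    omega

theorem asc_apply (m : Fin n) (l : ℕ) (hl : l ≤ m) (j : SignedSet n) (hj : j.1 = -((l : ℤ) + 1)) :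
    (((List.ofFn fun t : Fin l => tau (⟨t + 1, by omega⟩ : Fin n)).prod).1 j).1 = -1 := by
  induction l generalizing j with
  | zero => simpa using hj
  | succ l ih =>
    rw [List.ofFn_succ', List.concat_eq_append, List.prod_append, List.prod_singleton]
    refine ih (by omega) ((tau (⟨l + 1, by omega⟩ : Fin n)).1 j) ?_
    rw [tau_val]
    simp only [tauFun, hj]
    grind

theorem desc_zero_apply (m : Fin n) (j : SignedSet n) (hj : j.1 = -1) :
    ((desc tau m 0).1 j).1 = (m : ℤ) + 1 := by
  unfold desc
  rw [List.ofFn_succ', List.concat_eq_append, List.prod_append, List.prod_singleton]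
  refine desc_apply m m le_rfl ((tau (⟨m - (Fin.last m : ℕ), by omega⟩ : Fin n)).1 j) ?_
  rw [tau_val]
  simp [tauFun, hj]

theorem factor_apply (m : Fin n) (c : Bool × Fin (m + 1)) (j : SignedSet n)
    (hj : j.1 = spot c.1 c.2) : (factor tau m c).1 j = pos m := by
  apply Subtype.ext
  obtain ⟨b, l⟩ := c
  cases b
  · refine desc_apply m (m + 1 - (l + 1)) (by omega) j ?_
    simp only [spot] at hj
    simp at hj
    omega
  · refine desc_zero_apply m ((asc tau m l).1 j) ?_
    refine asc_apply m l (by omega) j ?_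
    simpa [spot] using hj

theorem partialProd_mem (c : NormalForm n) (k : ℕ) (hk : k ≤ n) :
    partialProd tau c k hk ∈ fixing n k := by
  induction k with
  | zero => exact one_mem _
  | succ k ih =>
    exact mul_mem (fixing_mono (Nat.le_succ k) (ih _)) (factor_mem ⟨k, hk⟩ _)

theorem spot_injective {b b' : Bool} {j j' : ℕ} (h : spot b j = spot b' j') :
    b = b' ∧ j = j' := by
  cases b <;> cases b' <;> simp [spot] at h ⊢ <;> omega

theorem spot_mem (m : Fin n) (c : Bool × Fin (m + 1)) :
    spot c.1 c.2 ≠ 0 ∧ |spot c.1 c.2| ≤ n := by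
  obtain ⟨b, l⟩ := c
  have := l.2
  have := m.2
  cases b <;> simp [spot, abs_le] <;> omega

theorem partialProd_succ_apply (c : NormalForm n) (k : ℕ) (hk : k + 1 ≤ n) :
    (partialProd tau c (k + 1) hk).1 ⟨spot (c ⟨k, hk⟩).1 (c ⟨k, hk⟩).2, spot_mem ⟨k, hk⟩ _⟩
      = pos ⟨k, hk⟩ := by
  change (partialProd tau c k _).1 ((factor tau ⟨k, hk⟩ (c ⟨k, hk⟩)).1 _) = _
  rw [factor_apply ⟨k, hk⟩ (c ⟨k, hk⟩) _ rfl]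
  refine partialProd_mem c k _ _ ?_
  simp only [pos]
  grind

theorem partialProd_injective (c c' : NormalForm n) (k : ℕ) (hk : k ≤ n)
    (h : partialProd tau c k hk = partialProd tau c' k hk) (m : Fin n) (hm : (m : ℕ) < k) :
    c m = c' m := by
  induction k with
  | zero => omega
  | succ k ih =>
    have key : c ⟨k, hk⟩ = c' ⟨k, hk⟩ := by
      have h1 := partialProd_succ_apply c k hk
      have h2 := partialProd_succ_apply c' k hk
      rw [← h, ← h1] at h2
      have h3 := congrArg Subtype.val ((partialProd tau c (k + 1) hk).1.injective h2)
      obtain ⟨e1, e2⟩ := spot_injective h3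
      exact Prod.ext e1.symm (Fin.ext e2.symm)
    by_cases hmk : (m : ℕ) = k
    · have : m = ⟨k, hk⟩ := Fin.ext hmk
      rw [this, key]
    · refine ih (Nat.le_of_succ_le hk) ?_ (by omega)
      simp only [partialProd, key] at h
      exact mul_right_cancel h

theorem partialProd_congr (c c' : NormalForm n) (k : ℕ) (hk : k ≤ n)
    (h : ∀ m : Fin n, (m : ℕ) < k → c m = c' m) :
    partialProd tau c k hk = partialProd tau c' k hk := by
  induction k with
  | zero => rfl
  | succ k ih =>
    simp only [partialProd]
    rw [ih _ (fun m hm => h m (by omega)), h ⟨k, hk⟩ (Nat.lt_succ_self k)]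

theorem partialProd_surjective (k : ℕ) (hk : k ≤ n) (ω : SignedPerm n) (hω : ω ∈ fixing n k) :
    ∃ c : NormalForm n, partialProd tau c k hk = ω := by
  classical
  induction k generalizing ω with
  | zero =>
    refine ⟨fun m => (false, 0), ?_⟩
    apply Subtype.ext
    apply Equiv.ext
    intro j
    exact (hω j (by simpa using j.2.1)).symm
  | succ k ih =>
    -- the position of `± (k + 1)` in the word of `ω` determines the last factor
    set p : SignedSet n := (ω⁻¹).1 (pos ⟨k, hk⟩) with hp
    have hωp : ω.1 p = pos ⟨k, hk⟩ := by
      exact ω.1.apply_symm_apply _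
    have hple : |p.1| ≤ (k + 1 : ℕ) := by
      by_contra hcon
      have h1 := hω p (by omega)
      rw [hωp] at h1
      rw [← h1] at hcon
      simp only [pos] at hcon
      grind
    obtain ⟨d, hd⟩ : ∃ d : Bool × Fin (k + 1), p.1 = spot d.1 d.2 := by
      have h0 := p.2.1
      rw [abs_le] at hple
      rcases lt_or_gt_of_ne h0 with h | h
      · refine ⟨(true, ⟨(-p.1 - 1).toNat, by omega⟩), ?_⟩
        simp [spot]; omega
      · refine ⟨(false, ⟨(p.1 - 1).toNat, by omega⟩), ?_⟩
        simp [spot]; omega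
    have hf : (factor tau ⟨k, hk⟩ d).1 p = pos ⟨k, hk⟩ := factor_apply ⟨k, hk⟩ d p hd
    have hmem : ω * (factor tau ⟨k, hk⟩ d)⁻¹ ∈ fixing n k := by
      have hbig : ω * (factor tau ⟨k, hk⟩ d)⁻¹ ∈ fixing n (k + 1) :=
        mul_mem hω (inv_mem (factor_mem ⟨k, hk⟩ d))
      have htop : (ω * (factor tau ⟨k, hk⟩ d)⁻¹).1 (pos ⟨k, hk⟩) = pos ⟨k, hk⟩ := by
        change ω.1 ((factor tau ⟨k, hk⟩ d).1⁻¹ (pos ⟨k, hk⟩)) = _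
        have hinv : (factor tau ⟨k, hk⟩ d).1⁻¹ (pos ⟨k, hk⟩) = p := by
          rw [Equiv.Perm.inv_eq_iff_eq, hf]
        rw [hinv, hωp]
      intro j hj
      by_cases hj' : ((k + 1 : ℕ) : ℤ) < |j.1|
      · exact hbig j hj'
      · have hj2 : |j.1| = (k : ℤ) + 1 := by push_cast at hj'; omega
        rcases (abs_eq (by omega)).mp hj2 with h | h
        · have : j = pos ⟨k, hk⟩ := Subtype.ext (by simpa [pos] using h)
          rw [this, htop]
        · have : j = -pos ⟨k, hk⟩ := Subtype.ext (by simpa [pos] using h)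
          rw [this, (ω * (factor tau ⟨k, hk⟩ d)⁻¹).2, htop]
    obtain ⟨c, hc⟩ := ih (Nat.le_of_succ_le hk) _ hmem
    refine ⟨Function.update c ⟨k, hk⟩ d, ?_⟩
    have hcongr := partialProd_congr (Function.update c ⟨k, hk⟩ d) c k (Nat.le_of_succ_le hk)
      (fun m hm => Function.update_of_ne (fun e => by rw [e] at hm; exact lt_irrefl _ hm) _ _)
    simp only [partialProd, Function.update_self]
    rw [hcongr, hc, inv_mul_cancel_right]

theorem normalProd_bijective :
    Function.Bijective (normalProd tau : NormalForm n → SignedPerm n) := by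
  constructor
  · intro c c' h
    funext m
    exact partialProd_injective c c' n le_rfl h m m.2
  · intro ω
    refine partialProd_surjective n le_rfl ω ?_
    intro j hj
    exact absurd j.2.2 (not_le.mpr hj)

end Bijective

/-- The normal form of a signed permutation `ω`: the unique choice of one element in each of the
sets whose product is `ω`. -/
noncomputable def normalForm {n : ℕ} : SignedPerm n ≃ NormalForm n :=
  (Equiv.ofBijective _ normalProd_bijective).symm

/-- `m_i(ω) = 1` if `τ_0` appears in the factor of `ω` from the `i`-th set, and `0` otherwise. -/
noncomputable def mult {n : ℕ} (ω : SignedPerm n) (i : Fin n) : ℕ :=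
  if (normalForm ω i).1 then 1 else 0

/-! ### The cyclotomic degenerate affine Hecke algebra -/

/-- The symbols `x_1, …, x_n` and `s_1, …, s_{n-1}`. -/
inductive Gen (n : ℕ) : Type
  | x (r : ℕ) (hr : 1 ≤ r ∧ r ≤ n) : Gen n
  | s (k : ℕ) (hk : 1 ≤ k ∧ k < n) : Gen n

/-- The letter `x_r` in the free algebra. -/
noncomputable def freeX {n : ℕ} (r : ℕ) (hr : 1 ≤ r ∧ r ≤ n) : FreeAlgebra ℂ (Gen n) :=
  FreeAlgebra.ι ℂ (Gen.x r hr)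

/-- The letter `s_k` in the free algebra. -/
noncomputable def freeS {n : ℕ} (k : ℕ) (hk : 1 ≤ k ∧ k < n) : FreeAlgebra ℂ (Gen n) :=
  FreeAlgebra.ι ℂ (Gen.s k hk)

/-- The defining relations of the cyclotomic degenerate affine Hecke algebra with cyclotomic
parameter `(κ₁, κ₂)`. -/
inductive HeckeRel (n : ℕ) (κ₁ κ₂ : ℂ) :
    FreeAlgebra ℂ (Gen n) → FreeAlgebra ℂ (Gen n) → Prop
  | quadratic (h : 1 ≤ 1 ∧ 1 ≤ n) :
      HeckeRel n κ₁ κ₂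
        ((freeX 1 h - algebraMap ℂ _ κ₁) * (freeX 1 h - algebraMap ℂ _ κ₂)) 0
  | x_s_comm (r l : ℕ) (hr : 1 ≤ r ∧ r ≤ n) (hl : 1 ≤ l ∧ l < n) (h : r ≠ l) (h' : r ≠ l + 1) :
      HeckeRel n κ₁ κ₂ (freeX r hr * freeS l hl) (freeS l hl * freeX r hr)
  | x_comm (r t : ℕ) (hr : 1 ≤ r ∧ r ≤ n) (ht : 1 ≤ t ∧ t ≤ n) :
      HeckeRel n κ₁ κ₂ (freeX r hr * freeX t ht) (freeX t ht * freeX r hr)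
  | x_succ (r : ℕ) (hr : 1 ≤ r ∧ r ≤ n) (hr' : 1 ≤ r + 1 ∧ r + 1 ≤ n) (hs : 1 ≤ r ∧ r < n) :
      HeckeRel n κ₁ κ₂ (freeX (r + 1) hr') (freeS r hs * freeX r hr * freeS r hs + freeS r hs)
  | s_sq (k : ℕ) (hk : 1 ≤ k ∧ k < n) :
      HeckeRel n κ₁ κ₂ (freeS k hk ^ 2) 1
  | s_comm (i j : ℕ) (hi : 1 ≤ i ∧ i < n) (hj : 1 ≤ j ∧ j < n) (h : i + 1 < j ∨ j + 1 < i) :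
      HeckeRel n κ₁ κ₂ (freeS i hi * freeS j hj) (freeS j hj * freeS i hi)
  | braid (k : ℕ) (hk : 1 ≤ k ∧ k < n) (hk' : 1 ≤ k + 1 ∧ k + 1 < n) :
      HeckeRel n κ₁ κ₂ (freeS k hk * freeS (k + 1) hk' * freeS k hk)
        (freeS (k + 1) hk' * freeS k hk * freeS (k + 1) hk')

/-- The cyclotomic degenerate affine Hecke algebra with parameter `(κ₁, κ₂)`. -/
abbrev Hecke (n : ℕ) (κ₁ κ₂ : ℂ) : Type := RingQuot (HeckeRel n κ₁ κ₂)

/-- The element `x_r` of the Hecke algebra. -/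
noncomputable def heckeX (n : ℕ) (κ₁ κ₂ : ℂ) (r : ℕ) (hr : 1 ≤ r ∧ r ≤ n) : Hecke n κ₁ κ₂ :=
  RingQuot.mkAlgHom ℂ (HeckeRel n κ₁ κ₂) (freeX r hr)

/-- The element `s_k` of the Hecke algebra. -/
noncomputable def heckeS (n : ℕ) (κ₁ κ₂ : ℂ) (k : ℕ) (hk : 1 ≤ k ∧ k < n) : Hecke n κ₁ κ₂ :=
  RingQuot.mkAlgHom ℂ (HeckeRel n κ₁ κ₂) (freeS k hk)

/-- The family `s_0 := x_1, s_1, …, s_{n-1}` of elements of the Hecke algebra. -/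
noncomputable def letter (n : ℕ) (κ₁ κ₂ : ℂ) (i : Fin n) : Hecke n κ₁ κ₂ :=
  if h : (i : ℕ) = 0 then heckeX n κ₁ κ₂ 1 ⟨le_rfl, by omega⟩
  else heckeS n κ₁ κ₂ i ⟨by omega, i.2⟩

/-- The element `s_ω` of the Hecke algebra, for `ω ∈ B_n`: the normal form
`ω = τ_{i_1} ⋯ τ_{i_k}` gives `s_ω = s_{i_1} ⋯ s_{i_k}`, with `s_0 = x_1`. -/
noncomputable def sElt (n : ℕ) (κ₁ κ₂ : ℂ) (ω : SignedPerm n) : Hecke n κ₁ κ₂ :=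
  normalProd (letter n κ₁ κ₂) (normalForm ω)

/-- The element `∑_{ω ∈ B_n} (∏_{i=0}^{n-1} (i - κ₂)^{1 - m_i(ω)}) s_ω`. -/
noncomputable def Ftilde (n : ℕ) (κ₁ κ₂ : ℂ) : Hecke n κ₁ κ₂ :=
  ∑ ω : SignedPerm n, (∏ i : Fin n, ((i : ℂ) - κ₂) ^ (1 - mult ω i)) • sElt n κ₁ κ₂ ω

/-- The element `Δ_k = x_1 · s_1 x_1 · s_2 s_1 x_1 ⋯ s_k ⋯ s_1 x_1`, for `k < n`. -/
noncomputable def Delta (n : ℕ) (κ₁ κ₂ : ℂ) (k : ℕ) (hk : k < n) : Hecke n κ₁ κ₂ :=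
  (List.ofFn fun m : Fin (k + 1) => desc (letter n κ₁ κ₂) ⟨m, by omega⟩ 0).prod

/-! ### The quotient algebra -/

/-- The additional relation, present when `n ≥ 2`. -/
inductive QuotRel (n : ℕ) (κ₁ κ₂ : ℂ) : Hecke n κ₁ κ₂ → Hecke n κ₁ κ₂ → Prop
  | rel (x s : Hecke n κ₁ κ₂) (hx : 1 ≤ 1 ∧ 1 ≤ n) (hs : 1 ≤ 1 ∧ 1 < n)
      (ex : x = heckeX n κ₁ κ₂ 1 hx) (es : s = heckeS n κ₁ κ₂ 1 hs) :
      QuotRel n κ₁ κ₂ ((x * s) ^ 2)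
        ((κ₁ * (1 + κ₁)) • (s - 1) + κ₁ • (s * x * s - s * x) + (1 + κ₁) • (x - x * s)
          + x * s * x)

/-- The algebra `A_n^κ`, the quotient of the Hecke algebra by the additional relation. -/
abbrev QuotAlg (n : ℕ) (κ₁ κ₂ : ℂ) : Type := RingQuot (QuotRel n κ₁ κ₂)

/-- The projection of the Hecke algebra onto `A_n^κ`. -/
noncomputable def toQuot (n : ℕ) (κ₁ κ₂ : ℂ) : Hecke n κ₁ κ₂ →ₐ[ℂ] QuotAlg n κ₁ κ₂ :=
  RingQuot.mkAlgHom ℂ (QuotRel n κ₁ κ₂)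

end FusedHecke

/-! Subtract from each x_r the constant 1 + κ₁ and the Jucys–Murphy element of the symmetric group.
The results T_1, …, T_n are permuted by conjugation. With k = κ₂ - κ₁ - 1, the quadratic relation
becomes (T_a + 1)(T_a - k) = 0, commutation of the x's becomes [T_a, T_b] = T_b s - s T_b, and the
extra relation becomes (T_a + 1) T_b (1 - s) = 0, where s is the transposition (a b).

Filter the algebra by the number of T's. Modulo lower terms the T's commute, have square zero, and
T_a T_b s = T_a T_b. So a monomial σ T_l depends only on the set l and on the coset of σ modulo the
permutations of l. One may take σ decreasing on l; such pairs (σ, l) are exactly the signed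
permutations avoiding 1̄2̄. The leading term of s_ω is σ T_l, where σ is the permutation underlying
ω and l its set of negative positions (`hasLeading_normalProd`), so these s_ω span (`filt_le_span`).

Independence comes from an explicit representation on functions of words with letters 1, …, n and an
empty symbol (`repData`). The leading terms, applied to the indicator of the word 1 2 … n, are
separated by their values at suitable words with empty places (`prod_apply`,
`linearIndependent_of_hasLeading`).

For the coefficient, Δ is the normal form of n̄ ⋯ 2̄ 1̄, the only avoiding element with n negative
values. If all m_i(ω) = 1, then s_ω ≡ Δ modulo lower terms and the scalar in front is 1; every other
s_ω is itself a lower term. There are ∏ (m + 1) = n! elements ω of the first kind. -/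

namespace FusedHecke

/-! ### The symmetric group and the relations of adjacent transpositions -/

section Adjacent

variable {M : Type*} [Monoid M]

/-- The relations of the adjacent transpositions `g 1, …, g (n-1)` of the symmetric group. -/
structure AdjacentRel (n : ℕ) (g : ℕ → M) : Prop where
  sq : ∀ i, 1 ≤ i → i < n → g i * g i = 1
  comm : ∀ i j, 1 ≤ i → i + 1 < j → j < n → g i * g j = g j * g i
  braid : ∀ i, 1 ≤ i → i + 1 < n → g i * g (i + 1) * g i = g (i + 1) * g i * g (i + 1)

/-- The product `g m * g (m - 1) * ⋯` with `l` factors. -/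
def down (g : ℕ → M) (m : ℕ) : ℕ → M
  | 0 => 1
  | l + 1 => down g m l * g (m - l)

/-- The product of the `down g m (c m)` for `m = 0, …, k - 1`. -/
def downProd (g : ℕ → M) (c : ℕ → ℕ) : ℕ → M
  | 0 => 1
  | k + 1 => downProd g c k * down g k (c k)

theorem map_down {N : Type*} [Monoid N] (f : M →* N) (g : ℕ → M) (m l : ℕ) :
    f (down g m l) = down (fun i => f (g i)) m l := by
  induction l with
  | zero => simp [down]
  | succ l ih => simp [down, ih]

theorem map_downProd {N : Type*} [Monoid N] (f : M →* N) (g : ℕ → M) (c : ℕ → ℕ) (k : ℕ) :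
    f (downProd g c k) = downProd (fun i => f (g i)) c k := by
  induction k with
  | zero => simp [downProd]
  | succ k ih => simp [downProd, ih, map_down]

theorem downProd_congr (g : ℕ → M) {c c' : ℕ → ℕ} {k : ℕ} (h : ∀ m < k, c m = c' m) :
    downProd g c k = downProd g c' k := by
  induction k with
  | zero => rfl
  | succ k ih => rw [downProd, downProd, ih fun m hm => h m (by omega), h k (by omega)]

variable {n : ℕ} {g : ℕ → M}

theorem AdjacentRel.down_mul_of_lt (h : AdjacentRel n g) {m l i : ℕ} (hm : m < n) (hi : 1 ≤ i)
    (hil : i + l < m) : down g m l * g i = g i * down g m l := by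
  induction l with
  | zero => simp [down]
  | succ l ih =>
    rw [down, mul_assoc, ← h.comm i (m - l) hi (by omega) (by omega), ← mul_assoc, ih (by omega),
      mul_assoc]

/-- The letter `g i` commutes leftwards until it meets the adjacent factors `g i * g (i - 1)`; one
braid move turns it into `g (i - 1)`, which commutes with everything further left. -/
theorem AdjacentRel.down_mul_of_gt (h : AdjacentRel n g) {m l i : ℕ} (hm : m < n) (hl : l ≤ m)
    (him : i ≤ m) (hil : m + 1 < i + l) : down g m l * g i = g (i - 1) * down g m l := by
  induction l with
  | zero => omega
  | succ l ih =>
    by_cases hcase : m + 1 < i + l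
    · rw [down, mul_assoc, h.comm (m - l) i (by omega) (by omega) (by omega), ← mul_assoc,
        ih (by omega) hcase, mul_assoc]
    · obtain ⟨p, rfl⟩ : ∃ p, l = p + 1 := ⟨l - 1, by omega⟩
      have e1 : m - (p + 1) = i - 1 := by omega
      have e2 : m - p = i - 1 + 1 := by omega
      have e3 : g i = g (i - 1 + 1) := congrArg g (by omega)
      rw [down, down, e1, e2, e3, mul_assoc, mul_assoc, ← mul_assoc (g (i - 1 + 1)),
        ← h.braid (i - 1) (by omega) (by omega), ← mul_assoc, ← mul_assoc,
        h.down_mul_of_lt hm (by omega) (by omega)]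
      simp only [mul_assoc]

/-- The last descending run has the form `g k * ⋯ * g (k - c k + 1)`. According to the position of
`i`, the new letter extends the run, cancels its last letter, commutes past it, or passes it as `g
(i - 1)`. In the last two cases a letter of index below `k` reaches the shorter product and
induction applies. -/
theorem AdjacentRel.exists_downProd_mul (h : AdjacentRel n g) {k : ℕ} (hk : k ≤ n) (c : ℕ → ℕ)
    (hc : ∀ m, c m ≤ m) {i : ℕ} (hi : 1 ≤ i) (hik : i < k) :
    ∃ c' : ℕ → ℕ, (∀ m, c' m ≤ m) ∧ downProd g c k * g i = downProd g c' k := by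
  induction k generalizing c i with
  | zero => omega
  | succ k ih =>
    have top : ∀ l ≤ k, down g k (c k) * g i = down g k l →
        ∃ c' : ℕ → ℕ, (∀ m, c' m ≤ m) ∧ downProd g c (k + 1) * g i = downProd g c' (k + 1) := by
      intro l hl e
      refine ⟨Function.update c k l, ?_, ?_⟩
      · intro m
        by_cases hm : m = k
        · subst hm; simpa using hl
        · simpa [hm] using hc m
      · rw [downProd, downProd, mul_assoc, e, Function.update_self]
        congr 1
        exact downProd_congr g fun m hm => (Function.update_of_ne (by omega) _ _).symm
    have low : ∀ j, 1 ≤ j → j < k → down g k (c k) * g i = g j * down g k (c k) →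
        ∃ c' : ℕ → ℕ, (∀ m, c' m ≤ m) ∧ downProd g c (k + 1) * g i = downProd g c' (k + 1) := by
      intro j hj hjk e
      obtain ⟨c', hc', e'⟩ := ih (by omega) c hc hj hjk
      refine ⟨Function.update c' k (c k), ?_, ?_⟩
      · intro m
        by_cases hm : m = k
        · subst hm; simpa using hc m
        · simpa [hm] using hc' m
      · rw [downProd, downProd, mul_assoc, e, ← mul_assoc, e', Function.update_self]
        congr 1
        exact downProd_congr g fun m hm => (Function.update_of_ne (by omega) _ _).symm
    have hck := hc k
    rcases lt_trichotomy (i + c k) (k + 1) with hlt | heq | hgt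
    · by_cases hik' : i + c k = k
      · refine top (c k + 1) (by omega) ?_
        rw [down]
        exact congrArg _ (congrArg g (by omega))
      · exact low i hi (by omega) (h.down_mul_of_lt (by omega) hi (by omega))
    · refine top (c k - 1) (by omega) ?_
      obtain ⟨p, hp⟩ : ∃ p, c k = p + 1 := ⟨c k - 1, by omega⟩
      have e1 : k - p = i := by omega
      rw [hp, down, e1, mul_assoc, h.sq i hi (by omega), mul_one, Nat.add_sub_cancel]
    · exact low (i - 1) (by omega) (by omega) (h.down_mul_of_gt (by omega) hck (by omega) (by omega))

/-- This gives the upper bound n! on the monoid generated by the `g i`. -/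
theorem AdjacentRel.mem_closure (h : AdjacentRel n g) {x : M}
    (hx : x ∈ Submonoid.closure (g '' {i | 1 ≤ i ∧ i < n})) :
    ∃ c : ℕ → ℕ, (∀ m, c m ≤ m) ∧ x = downProd g c n := by
  induction hx using Submonoid.closure_induction_right with
  | one =>
    refine ⟨fun _ => 0, fun m => Nat.zero_le m, ?_⟩
    have : ∀ k, downProd g (fun _ => 0) k = 1 := fun k => by
      induction k with
      | zero => rfl
      | succ k ih => simp [downProd, down, ih]
    exact (this n).symm
  | mul_right x hx y hy ih =>
    obtain ⟨i, ⟨hi, hin⟩, rfl⟩ := hy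
    obtain ⟨c, hc, rfl⟩ := ih
    exact h.exists_downProd_mul le_rfl c hc hi hin

end Adjacent

/-- The transposition of the elements number `i - 1` and `i` of `Fin n`, for `1 ≤ i < n`. -/
def adjSwap (n i : ℕ) : Equiv.Perm (Fin n) :=
  if h : 1 ≤ i ∧ i < n then Equiv.swap ⟨i - 1, by omega⟩ ⟨i, h.2⟩ else 1

theorem adjSwap_of_lt {n i : ℕ} (hi : 1 ≤ i) (hin : i < n) :
    adjSwap n i = Equiv.swap ⟨i - 1, by omega⟩ ⟨i, hin⟩ := dif_pos ⟨hi, hin⟩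

theorem adjSwap_mul_self (n i : ℕ) : adjSwap n i * adjSwap n i = 1 := by
  unfold adjSwap
  split
  · exact Equiv.swap_mul_self _ _
  · rfl

theorem adjSwap_rel (n : ℕ) : AdjacentRel n (adjSwap n) where
  sq i _ _ := adjSwap_mul_self n i
  comm i j hi hij hj := by
    rw [adjSwap_of_lt hi (by omega), adjSwap_of_lt (by omega) hj]
    ext x
    simp only [Equiv.Perm.mul_apply, Equiv.swap_apply_def, Fin.ext_iff]
    grind
  braid i hi hin := by
    rw [adjSwap_of_lt hi (by omega), adjSwap_of_lt (by omega) hin]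
    ext x
    simp only [Equiv.Perm.mul_apply, Equiv.swap_apply_def, Fin.ext_iff]
    grind

theorem closure_adjSwap (n : ℕ) :
    Submonoid.closure (adjSwap n '' {i | 1 ≤ i ∧ i < n}) = ⊤ := by
  cases n with
  | zero => exact Subsingleton.elim _ _
  | succ n =>
    rw [eq_top_iff, ← Equiv.Perm.mclosure_swap_castSucc_succ n]
    refine Submonoid.closure_mono ?_
    rintro _ ⟨i, rfl⟩
    refine ⟨i + 1, ⟨by omega, by omega⟩, ?_⟩
    rw [adjSwap_of_lt (by omega) (by omega)]
    rfl

/-- There are n! codes and they exhaust a group with n! elements, so no two of them give the same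
permutation. -/
theorem downProd_adjSwap_injective {n : ℕ} {c c' : ℕ → ℕ} (hc : ∀ m, c m ≤ m)
    (hc' : ∀ m, c' m ≤ m) (h : downProd (adjSwap n) c n = downProd (adjSwap n) c' n) :
    ∀ m < n, c m = c' m := by
  let F : ((m : Fin n) → Fin (m + 1)) → Equiv.Perm (Fin n) := fun d =>
    downProd (adjSwap n) (fun m => if hm : m < n then d ⟨m, hm⟩ else 0) n
  let D : (e : ℕ → ℕ) → (∀ m, e m ≤ m) → (m : Fin n) → Fin (m + 1) := fun e he m =>
    ⟨e m, Nat.lt_succ_of_le (he m)⟩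
  have hF : ∀ (e : ℕ → ℕ) (he : ∀ m, e m ≤ m), F (D e he) = downProd (adjSwap n) e n := by
    intro e he
    refine downProd_congr _ fun m hm => ?_
    simp [hm, D]
  have hsurj : Function.Surjective F := by
    intro σ
    obtain ⟨e, he, rfl⟩ := (adjSwap_rel n).mem_closure (x := σ)
      (by rw [closure_adjSwap]; exact Submonoid.mem_top _)
    exact ⟨_, hF e he⟩
  have hcard : Fintype.card ((m : Fin n) → Fin (m + 1)) = Fintype.card (Equiv.Perm (Fin n)) := by
    rw [Fintype.card_perm, Fintype.card_pi, Fintype.card_fin]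
    simp only [Fintype.card_fin]
    rw [Fin.prod_univ_eq_prod_range (fun m => m + 1), Finset.prod_range_add_one_eq_factorial]
  have hinj := ((Fintype.bijective_iff_surjective_and_card F).mpr ⟨hsurj, hcard⟩).1
  intro m hm
  rw [← hF c hc, ← hF c' hc'] at h
  exact congrArg Fin.val (congrFun (hinj h) ⟨m, hm⟩)

/-- The adjacent transpositions and their relations present the symmetric group. -/
theorem AdjacentRel.exists_hom {M : Type*} [Monoid M] {n : ℕ} {g : ℕ → M}
    (h : AdjacentRel n g) :
    ∃ ρ : Equiv.Perm (Fin n) →* M, ∀ i, 1 ≤ i → i < n → ρ (adjSwap n i) = g i := by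
  -- The homomorphism is built from its graph: the pairs `G i` satisfy the same relations, and the
  -- submonoid they generate projects bijectively to the symmetric group because its elements and
  -- the permutations have the same normal forms.
  let G : ℕ → M × Equiv.Perm (Fin n) := fun i => (g i, adjSwap n i)
  have hG : AdjacentRel n G :=
    ⟨fun i hi hin => Prod.ext (h.sq i hi hin) ((adjSwap_rel n).sq i hi hin),
      fun i j hi hij hj => Prod.ext (h.comm i j hi hij hj) ((adjSwap_rel n).comm i j hi hij hj),
      fun i hi hin => Prod.ext (h.braid i hi hin) ((adjSwap_rel n).braid i hi hin)⟩
  let N := Submonoid.closure (G '' {i | 1 ≤ i ∧ i < n})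
  have hmem : ∀ i, 1 ≤ i → i < n → G i ∈ N := fun i hi hin =>
    Submonoid.subset_closure ⟨i, ⟨hi, hin⟩, rfl⟩
  let p : N →* Equiv.Perm (Fin n) := (MonoidHom.snd _ _).comp N.subtype
  have hp : Function.Bijective p := by
    constructor
    · rintro ⟨x, hx⟩ ⟨y, hy⟩ hxy
      obtain ⟨c, hc, rfl⟩ := hG.mem_closure hx
      obtain ⟨c', hc', rfl⟩ := hG.mem_closure hy
      apply Subtype.ext
      refine downProd_congr G (downProd_adjSwap_injective hc hc' ?_)
      have e : ∀ c, downProd (adjSwap n) c n = (downProd G c n).2 := fun c =>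
        (map_downProd (MonoidHom.snd M (Equiv.Perm (Fin n))) G c n).symm
      rw [e, e]
      exact hxy
    · rw [← MonoidHom.mrange_eq_top, eq_top_iff, ← closure_adjSwap, Submonoid.closure_le]
      rintro _ ⟨i, ⟨hi, hin⟩, rfl⟩
      exact ⟨⟨G i, hmem i hi hin⟩, rfl⟩
  let e := MulEquiv.ofBijective p hp
  refine ⟨((MonoidHom.fst _ _).comp N.subtype).comp e.symm.toMonoidHom, fun i hi hin => ?_⟩
  have : e.symm (adjSwap n i) = ⟨G i, hmem i hi hin⟩ := by
    rw [MulEquiv.symm_apply_eq]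
    rfl
  change ((e.symm (adjSwap n i) : N) : M × Equiv.Perm (Fin n)).1 = g i
  rw [this]

/-! ### Shifted generators -/

section JucysMurphy

variable {B : Type*} [Ring B] {n : ℕ}

/-- The sum of the images of the transpositions of `i` and `r`, for `i < r`. -/
def jucysMurphy (ρ : Equiv.Perm (Fin n) →* B) (r : Fin n) : B :=
  ∑ i with i < r, ρ (Equiv.swap i r)

theorem commute_jucysMurphy (ρ : Equiv.Perm (Fin n) →* B) {σ : Equiv.Perm (Fin n)} {r : Fin n}
    (hr : σ r = r) (hσ : ∀ i, i < r ↔ σ i < r) : Commute (ρ σ) (jucysMurphy ρ r) := by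
  unfold Commute SemiconjBy jucysMurphy
  rw [Finset.mul_sum, Finset.sum_mul]
  refine Finset.sum_equiv σ (fun i => by simpa using hσ i) fun i _ => ?_
  rw [← map_mul, ← map_mul, Equiv.mul_swap_eq_swap_mul, hr]

theorem jucysMurphy_succ (ρ : Equiv.Perm (Fin n) →* B) {r r' : Fin n}
    (h : (r' : ℕ) = r + 1) :
    jucysMurphy ρ r' = ρ (Equiv.swap r r') * jucysMurphy ρ r * ρ (Equiv.swap r r')
      + ρ (Equiv.swap r r') := by
  have hrr : r ≠ r' := fun e => by simp [e] at h
  have hins : (Finset.univ.filter fun i => i < r') = insert r (Finset.univ.filter fun i => i < r) := by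
    ext i
    simp only [Finset.mem_filter, Finset.mem_univ, true_and, Finset.mem_insert, Fin.lt_def,
      Fin.ext_iff]
    omega
  unfold jucysMurphy
  rw [hins, Finset.sum_insert (by simp), add_comm, Finset.mul_sum, Finset.sum_mul]
  congr 1
  refine Finset.sum_congr rfl fun i hi => ?_
  simp only [Finset.mem_filter, Finset.mem_univ, true_and] at hi
  have h1 : i ≠ r := hi.ne
  have h2 : i ≠ r' := fun e => by rw [e, Fin.lt_def] at hi; omega
  rw [← map_mul, ← map_mul, Equiv.mul_swap_eq_swap_mul (Equiv.swap r r') i r, mul_assoc,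
    Equiv.swap_mul_self, mul_one, Equiv.swap_apply_left, Equiv.swap_apply_of_ne_of_ne h1 h2]

end JucysMurphy

/-- The images in an algebra of the permutations and of the operators `T a`, which are the
differences of the generators and of the Jucys–Murphy elements, up to a constant. -/
structure FusedData (n : ℕ) (k : ℂ) (B : Type*) [Ring B] [Algebra ℂ B] where
  ρ : Equiv.Perm (Fin n) →* B
  T : Fin n → B
  conj : ∀ σ a, ρ σ * T a = T (σ a) * ρ σ
  quad : ∀ a, T a * T a = (k - 1) • T a + k • 1
  comm : ∀ a b, a ≠ b → T a * T b - T b * T a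
    = T b * ρ (Equiv.swap a b) - ρ (Equiv.swap a b) * T b
  fuse : ∀ a b, a ≠ b → (T a + 1) * T b * (1 - ρ (Equiv.swap a b)) = 0

theorem exists_perm_pair {α : Type*} [DecidableEq α] {x y a b : α} (hxy : x ≠ y) (hab : a ≠ b) :
    ∃ σ : Equiv.Perm α, σ x = a ∧ σ y = b := by
  refine ⟨Equiv.swap (Equiv.swap x a y) b * Equiv.swap x a, ?_, ?_⟩
  · rw [Equiv.Perm.mul_apply, Equiv.swap_apply_left]
    refine Equiv.swap_apply_of_ne_of_ne (fun e => hxy ?_) hab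
    rw [← Equiv.swap_apply_left x a] at e
    exact (Equiv.swap x a).injective (by simpa using e)
  · rw [Equiv.Perm.mul_apply, Equiv.swap_apply_left]

section Basic

variable {n : ℕ} {B : Type*} [Ring B] [Algebra ℂ B] {k : ℂ}

/-- It is enough to check the relations of `FusedData` at the indices `0` and `1`. -/
def FusedData.ofZero (hn : 0 < n) (ρ : Equiv.Perm (Fin n) →* B) (T : Fin n → B)
    (conj : ∀ σ a, ρ σ * T a = T (σ a) * ρ σ)
    (quad : T ⟨0, hn⟩ * T ⟨0, hn⟩ = (k - 1) • T ⟨0, hn⟩ + k • 1)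
    (comm : ∀ h : 1 < n, T ⟨0, hn⟩ * T ⟨1, h⟩ - T ⟨1, h⟩ * T ⟨0, hn⟩
      = T ⟨1, h⟩ * ρ (Equiv.swap ⟨0, hn⟩ ⟨1, h⟩) - ρ (Equiv.swap ⟨0, hn⟩ ⟨1, h⟩) * T ⟨1, h⟩)
    (fuse : ∀ h : 1 < n,
      (T ⟨0, hn⟩ + 1) * T ⟨1, h⟩ * (1 - ρ (Equiv.swap ⟨0, hn⟩ ⟨1, h⟩)) = 0) :
    FusedData n k B := by
  have inv : ∀ σ, ρ σ * ρ σ⁻¹ = 1 := fun σ => by rw [← map_mul, mul_inv_cancel, map_one]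
  have cT : ∀ σ a b, σ a = b → T b = ρ σ * T a * ρ σ⁻¹ := by
    rintro σ a b rfl
    rw [conj, mul_assoc, inv, mul_one]
  have cS : ∀ σ a b a' b', σ a = a' → σ b = b' →
      ρ (Equiv.swap a' b') = ρ σ * ρ (Equiv.swap a b) * ρ σ⁻¹ := by
    rintro σ a b _ _ rfl rfl
    rw [← map_mul, Equiv.mul_swap_eq_swap_mul, map_mul, mul_assoc, inv, mul_one]
  have cM : ∀ σ x y, ρ σ * x * ρ σ⁻¹ * (ρ σ * y * ρ σ⁻¹) = ρ σ * (x * y) * ρ σ⁻¹ := by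
    intro σ x y
    have : ρ σ⁻¹ * ρ σ = 1 := by rw [← map_mul, inv_mul_cancel, map_one]
    calc _ = ρ σ * x * (ρ σ⁻¹ * ρ σ) * y * ρ σ⁻¹ := by simp only [mul_assoc]
      _ = _ := by rw [this]; simp only [mul_assoc, mul_one]
  have cO : ∀ σ, (1 : B) = ρ σ * 1 * ρ σ⁻¹ := fun σ => by rw [mul_one, inv]
  refine ⟨ρ, T, conj, fun a => ?_, fun a b hab => ?_, fun a b hab => ?_⟩
  · have e := cT (Equiv.swap ⟨0, hn⟩ a) ⟨0, hn⟩ a (Equiv.swap_apply_left _ _)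
    rw [e, cM, quad, cO (Equiv.swap ⟨0, hn⟩ a)]
    simp only [mul_add, add_mul, mul_smul_comm, smul_mul_assoc, mul_one, inv]
  · have h : 1 < n := by
      have := a.2; have := b.2
      have : (a : ℕ) ≠ b := fun e => hab (Fin.ext e)
      omega
    -- By double transitivity some σ carries (0, 1) to (a, b); the relation at (a, b) is then the
    -- conjugate by σ of the relation at (0, 1).
    obtain ⟨σ, ha, hb⟩ := exists_perm_pair (x := (⟨0, hn⟩ : Fin n)) (y := ⟨1, h⟩)
      (by simp) hab
    rw [cT σ _ _ ha, cT σ _ _ hb, cS σ _ _ _ _ ha hb, cM, cM, cM, cM, ← sub_mul, ← mul_sub,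
      comm h, mul_sub, sub_mul]
  · have h : 1 < n := by
      have := a.2; have := b.2
      have : (a : ℕ) ≠ b := fun e => hab (Fin.ext e)
      omega
    obtain ⟨σ, ha, hb⟩ := exists_perm_pair (x := (⟨0, hn⟩ : Fin n)) (y := ⟨1, h⟩)
      (by simp) hab
    rw [cT σ _ _ ha, cT σ _ _ hb, cS σ _ _ _ _ ha hb, cO σ, ← add_mul, ← mul_add, cM, ← sub_mul,
      ← mul_sub, cM, fuse h, mul_zero, zero_mul]

end Basic

/-- The defining relations of `A_n^κ`, for `X r = x_{r+1}` and `S i = s_i`. -/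
structure FusedRel (n : ℕ) (κ₁ κ₂ : ℂ) {A : Type*} [Ring A] [Algebra ℂ A]
    (X : Fin n → A) (S : ℕ → A) : Prop where
  adj : AdjacentRel n S
  quad : ∀ h : 0 < n, (X ⟨0, h⟩ - algebraMap ℂ A κ₁) * (X ⟨0, h⟩ - algebraMap ℂ A κ₂) = 0
  x_s : ∀ (r : Fin n) (i : ℕ), 1 ≤ i → i < n → (r : ℕ) + 1 ≠ i → (r : ℕ) ≠ i →
    X r * S i = S i * X r
  x_comm : ∀ r t, X r * X t = X t * X r
  x_succ : ∀ (i : ℕ) (_ : 1 ≤ i) (h : i < n),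
    X ⟨i, h⟩ = S i * X ⟨i - 1, by omega⟩ * S i + S i
  extra : ∀ h : 1 < n, (X ⟨0, by omega⟩ * S 1) ^ 2
    = (κ₁ * (1 + κ₁)) • (S 1 - 1)
      + κ₁ • (S 1 * X ⟨0, by omega⟩ * S 1 - S 1 * X ⟨0, by omega⟩)
      + (1 + κ₁) • (X ⟨0, by omega⟩ - X ⟨0, by omega⟩ * S 1)
      + X ⟨0, by omega⟩ * S 1 * X ⟨0, by omega⟩

namespace FusedRel

variable {n : ℕ} {κ₁ κ₂ : ℂ} {A : Type*} [Ring A] [Algebra ℂ A] {X : Fin n → A} {S : ℕ → A}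
  (R : FusedRel n κ₁ κ₂ X S)

/-- The permutations in the algebra. -/
noncomputable def perm : Equiv.Perm (Fin n) →* A := R.adj.exists_hom.choose

theorem perm_adjSwap {i : ℕ} (hi : 1 ≤ i) (hin : i < n) : R.perm (adjSwap n i) = S i :=
  R.adj.exists_hom.choose_spec i hi hin

/-- The shifted generators. -/
noncomputable def shift (r : Fin n) : A :=
  X r - algebraMap ℂ A (1 + κ₁) - jucysMurphy R.perm r

theorem X_eq (r : Fin n) :
    X r = R.shift r + algebraMap ℂ A (1 + κ₁) + jucysMurphy R.perm r := by
  unfold shift; abel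

theorem shift_zero (hn : 0 < n) : R.shift ⟨0, hn⟩ = X ⟨0, hn⟩ - algebraMap ℂ A (1 + κ₁) := by
  have : jucysMurphy R.perm ⟨0, hn⟩ = 0 := Finset.sum_eq_zero fun i hi => by
    simp [Fin.lt_def] at hi
  rw [shift, this, sub_zero]

/-- The generators and the Jucys–Murphy elements obey the same recursion y ↦ s y s + s. The
inhomogeneous term cancels in the difference, leaving pure conjugation. -/
theorem shift_succ {i : ℕ} (hi : 1 ≤ i) (hin : i < n) :
    R.shift ⟨i, hin⟩ = S i * R.shift ⟨i - 1, by omega⟩ * S i := by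
  have hj := jucysMurphy_succ R.perm (r := (⟨i - 1, by omega⟩ : Fin n))
    (r' := ⟨i, hin⟩) (by simp; omega)
  rw [← adjSwap_of_lt hi hin, R.perm_adjSwap hi hin] at hj
  have hc : S i * algebraMap ℂ A (1 + κ₁) * S i = algebraMap ℂ A (1 + κ₁) := by
    rw [← Algebra.commutes, mul_assoc, R.adj.sq i hi hin, mul_one]
  rw [shift, shift, hj, R.x_succ i hi hin, mul_sub, sub_mul, mul_sub, sub_mul, hc]
  abel

theorem conj (σ : Equiv.Perm (Fin n)) (a : Fin n) :
    R.perm σ * R.shift a = R.shift (σ a) * R.perm σ := by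
  have key : ∀ i, 1 ≤ i → i < n → ∀ a,
      R.perm (adjSwap n i) * R.shift a = R.shift (adjSwap n i a) * R.perm (adjSwap n i) := by
    intro i hi hin a
    have hs := R.adj.sq i hi hin
    by_cases h1 : (a : ℕ) = i
    · obtain rfl : a = ⟨i, hin⟩ := Fin.ext h1
      have : adjSwap n i ⟨i, hin⟩ = ⟨i - 1, by omega⟩ := by
        rw [adjSwap_of_lt hi hin, Equiv.swap_apply_right]
      rw [this, R.perm_adjSwap hi hin, R.shift_succ hi hin, ← mul_assoc, ← mul_assoc, hs,
        one_mul]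
    by_cases h2 : (a : ℕ) + 1 = i
    · have ha : a = ⟨i - 1, by omega⟩ := Fin.ext (by simp; omega)
      have : adjSwap n i a = ⟨i, hin⟩ := by
        rw [adjSwap_of_lt hi hin, ha, Equiv.swap_apply_left]
      rw [this, R.perm_adjSwap hi hin, R.shift_succ hi hin, mul_assoc, mul_assoc, hs,
        mul_one, ha]
    have hfix : adjSwap n i a = a := by
      rw [adjSwap_of_lt hi hin]
      exact Equiv.swap_apply_of_ne_of_ne (fun e => h2 (by simp [e]; omega))
        (fun e => h1 (by simp [e]))
    have hJ := commute_jucysMurphy R.perm hfix (fun b => by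
      rw [adjSwap_of_lt hi hin]
      simp only [Equiv.swap_apply_def, Fin.lt_def, Fin.ext_iff]
      grind)
    rw [hfix, shift, mul_sub, mul_sub, sub_mul, sub_mul, hJ.eq, R.perm_adjSwap hi hin,
      R.x_s a i hi hin h2 h1, Algebra.commutes]
  have hσ : σ ∈ Submonoid.closure (adjSwap n '' {i | 1 ≤ i ∧ i < n}) := by
    rw [closure_adjSwap]; exact Submonoid.mem_top _
  induction hσ using Submonoid.closure_induction generalizing a with
  | mem x hx =>
    obtain ⟨i, ⟨hi, hin⟩, rfl⟩ := hx
    exact key i hi hin a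
  | one => simp
  | mul x y _ _ hx hy => rw [map_mul, mul_assoc, hy, ← mul_assoc, hx, mul_assoc]; rfl

end FusedRel

theorem swap_zero_one {n : ℕ} (h : 1 < n) :
    Equiv.swap (⟨0, by omega⟩ : Fin n) ⟨1, h⟩ = adjSwap n 1 :=
  (adjSwap_of_lt le_rfl h).symm

/-! ### The defining relations rewritten for the shifted generators -/

section ShiftIdentities

variable {A : Type*} [Ring A] [Algebra ℂ A]

/-- The shift by 1 + κ₁ moves the roots κ₁, κ₂ to -1 and k = κ₂ - κ₁ - 1. -/
theorem shift_quad_iff {κ₁ κ₂ : ℂ} {x t : A} (h : x = t + (1 + κ₁) • 1) :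
    (x - κ₁ • 1) * (x - κ₂ • 1) = 0 ↔ t * t = (κ₂ - κ₁ - 1 - 1) • t + (κ₂ - κ₁ - 1) • 1 := by
  have e : (x - κ₁ • 1) * (x - κ₂ • 1)
      = t * t - ((κ₂ - κ₁ - 1 - 1) • t + (κ₂ - κ₁ - 1) • 1) := by
    rw [h]
    simp only [add_mul, mul_add, sub_mul, mul_sub, mul_smul_comm, smul_mul_assoc, mul_one, one_mul,
      smul_add, smul_sub, smul_smul]
    module
  rw [e, sub_eq_zero]

/-- With T_0 = t and T_1 = s t s, the right-hand side is `FusedData.comm`; the constant `c` drops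
out. -/
theorem shift_comm_iff {c : ℂ} {x t s : A} (hs : s * s = 1) (h : x = t + c • 1) :
    x * (s * x * s + s) = (s * x * s + s) * x ↔
      t * (s * t * s) - s * t * s * t = s * t * s * s - s * (s * t * s) := by
  have e : x * (s * x * s + s) - (s * x * s + s) * x
      = t * (s * t * s) - s * t * s * t - (s * t * s * s - s * (s * t * s)) := by
    have hs2 : ∀ y, s * (s * y) = y := fun y => by rw [← mul_assoc, hs, one_mul]
    rw [h]
    simp only [add_mul, mul_add, mul_smul_comm, smul_mul_assoc, mul_one, one_mul,
      smul_add, smul_smul, mul_assoc, hs, hs2]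
    module
  rw [← sub_eq_zero, e, sub_eq_zero]

/-- This explains the constant 1 + κ₁: with it the difference of the two sides of the extra relation
factors completely. -/
theorem shift_extra_iff {κ : ℂ} {x t s : A} (hs : s * s = 1) (h : x = t + (1 + κ) • 1) :
    (x * s) ^ 2 = (κ * (1 + κ)) • (s - 1) + κ • (s * x * s - s * x) + (1 + κ) • (x - x * s)
      + x * s * x ↔ (t + 1) * (s * t * s) * (1 - s) = 0 := by
  have e : (x * s) ^ 2 - ((κ * (1 + κ)) • (s - 1) + κ • (s * x * s - s * x)
      + (1 + κ) • (x - x * s) + x * s * x) = (t + 1) * (s * t * s) * (1 - s) := by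
    rw [h, pow_two]
    simp only [add_mul, mul_add, mul_sub, mul_smul_comm, smul_mul_assoc, mul_one, one_mul,
      smul_add, smul_sub, smul_smul, mul_assoc, hs]
    module
  rw [← sub_eq_zero, e]

end ShiftIdentities

/-- The permutations and the shifted generators. -/
noncomputable def FusedRel.data {n : ℕ} {κ₁ κ₂ : ℂ} {A : Type*} [Ring A] [Algebra ℂ A]
    {X : Fin n → A} {S : ℕ → A} (R : FusedRel n κ₁ κ₂ X S) (hn : 0 < n) :
    FusedData n (κ₂ - κ₁ - 1) A :=
  have hX : X ⟨0, hn⟩ = R.shift ⟨0, hn⟩ + (1 + κ₁) • 1 := by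
    rw [R.shift_zero hn, Algebra.algebraMap_eq_smul_one, sub_add_cancel]
  FusedData.ofZero hn R.perm R.shift R.conj
    (by
      have := R.quad hn
      simp only [Algebra.algebraMap_eq_smul_one] at this
      exact (shift_quad_iff hX).mp this)
    (by
      intro h
      have hx := R.x_comm ⟨0, hn⟩ ⟨1, h⟩
      rw [R.x_succ 1 le_rfl h] at hx
      rw [swap_zero_one h, R.perm_adjSwap le_rfl h, R.shift_succ le_rfl h]
      exact (shift_comm_iff (R.adj.sq 1 le_rfl h) hX).mp hx)
    (by
      intro h
      rw [swap_zero_one h, R.perm_adjSwap le_rfl h, R.shift_succ le_rfl h]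
      exact (shift_extra_iff (R.adj.sq 1 le_rfl h) hX).mp (R.extra h))

/-! ### The filtration by the number of shifted generators -/

theorem perm_apply_inv {α : Type*} (σ : Equiv.Perm α) (a : α) : σ (σ⁻¹ a) = a :=
  σ.apply_symm_apply a

namespace FusedData

variable {n : ℕ} {k : ℂ} {B : Type*} [Ring B] [Algebra ℂ B] (D : FusedData n k B)

/-- A permutation times a product of shifted generators. -/
def mono (σ : Equiv.Perm (Fin n)) (l : List (Fin n)) : B := D.ρ σ * (l.map D.T).prod

/-- The span of the products with less than `d` shifted generators. -/
def filt (d : ℕ) : Submodule ℂ B :=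
  Submodule.span ℂ {x | ∃ σ l, l.length < d ∧ x = D.mono σ l}

variable {D}

theorem mono_mem_filt {σ : Equiv.Perm (Fin n)} {l : List (Fin n)} {d : ℕ} (h : l.length < d) :
    D.mono σ l ∈ D.filt d := Submodule.subset_span ⟨σ, l, h, rfl⟩

theorem filt_mono {d e : ℕ} (h : d ≤ e) : D.filt d ≤ D.filt e := by
  refine Submodule.span_mono ?_
  rintro _ ⟨σ, l, hl, rfl⟩
  exact ⟨σ, l, by omega, rfl⟩

theorem map_mem_of_mem_filt {d e : ℕ} (f : B →ₗ[ℂ] B)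
    (hf : ∀ σ l, l.length < d → f (D.mono σ l) ∈ D.filt e) {x : B} (hx : x ∈ D.filt d) :
    f x ∈ D.filt e := by
  have : D.filt d ≤ (D.filt e).comap f := by
    refine Submodule.span_le.mpr ?_
    rintro _ ⟨σ, l, hl, rfl⟩
    exact hf σ l hl
  exact this hx

theorem prod_mul_perm (l : List (Fin n)) (τ : Equiv.Perm (Fin n)) :
    (l.map D.T).prod * D.ρ τ = D.ρ τ * ((l.map ⇑τ⁻¹).map D.T).prod := by
  induction l with
  | nil => simp
  | cons a l ih =>
    rw [List.map_cons, List.prod_cons, mul_assoc, ih, List.map_cons, List.map_cons, List.prod_cons,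
      ← mul_assoc, ← mul_assoc, D.conj, perm_apply_inv]

theorem mono_mul_perm (σ τ : Equiv.Perm (Fin n)) (l : List (Fin n)) :
    D.mono σ l * D.ρ τ = D.mono (σ * τ) (l.map ⇑τ⁻¹) := by
  rw [mono, mono, mul_assoc, prod_mul_perm, map_mul, mul_assoc]

theorem perm_mul_mono (σ τ : Equiv.Perm (Fin n)) (l : List (Fin n)) :
    D.ρ τ * D.mono σ l = D.mono (τ * σ) l := by
  rw [mono, mono, map_mul, mul_assoc]

theorem mono_mul_T (σ : Equiv.Perm (Fin n)) (l : List (Fin n)) (a : Fin n) :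
    D.mono σ l * D.T a = D.mono σ (l ++ [a]) := by
  simp [mono, mul_assoc]

theorem T_mul_mono (σ : Equiv.Perm (Fin n)) (l : List (Fin n)) (a : Fin n) :
    D.T a * D.mono σ l = D.mono σ (σ⁻¹ a :: l) := by
  have := D.conj σ (σ⁻¹ a)
  rw [perm_apply_inv] at this
  rw [mono, mono, ← mul_assoc, ← this, List.map_cons, List.prod_cons, mul_assoc]

theorem mul_perm_mem {d : ℕ} {x : B} (hx : x ∈ D.filt d) (τ : Equiv.Perm (Fin n)) :
    x * D.ρ τ ∈ D.filt d :=
  map_mem_of_mem_filt (LinearMap.mulRight ℂ (D.ρ τ)) (fun σ l hl => by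
    rw [LinearMap.mulRight_apply, mono_mul_perm]
    exact mono_mem_filt (by simpa using hl)) hx

theorem perm_mul_mem {d : ℕ} {x : B} (hx : x ∈ D.filt d) (τ : Equiv.Perm (Fin n)) :
    D.ρ τ * x ∈ D.filt d :=
  map_mem_of_mem_filt (LinearMap.mulLeft ℂ (D.ρ τ)) (fun σ l hl => by
    rw [LinearMap.mulLeft_apply, perm_mul_mono]
    exact mono_mem_filt hl) hx

theorem mul_T_mem {d : ℕ} {x : B} (hx : x ∈ D.filt d) (a : Fin n) :
    x * D.T a ∈ D.filt (d + 1) :=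
  map_mem_of_mem_filt (LinearMap.mulRight ℂ (D.T a)) (fun σ l hl => by
    rw [LinearMap.mulRight_apply, mono_mul_T]
    exact mono_mem_filt (by simpa using hl)) hx

theorem T_mul_mem {d : ℕ} {x : B} (hx : x ∈ D.filt d) (a : Fin n) :
    D.T a * x ∈ D.filt (d + 1) :=
  map_mem_of_mem_filt (LinearMap.mulLeft ℂ (D.T a)) (fun σ l hl => by
    rw [LinearMap.mulLeft_apply, T_mul_mono]
    exact mono_mem_filt (by simpa using hl)) hx

theorem mul_prod_mem {d : ℕ} {x : B} (hx : x ∈ D.filt d) (l : List (Fin n)) :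
    x * (l.map D.T).prod ∈ D.filt (d + l.length) := by
  induction l generalizing d x with
  | nil => simpa using hx
  | cons a l ih =>
    rw [List.map_cons, List.prod_cons, ← mul_assoc]
    have := ih (mul_T_mem hx a)
    rwa [List.length_cons, add_comm l.length, ← add_assoc]

theorem prod_mul_mem {d : ℕ} {x : B} (hx : x ∈ D.filt d) (l : List (Fin n)) :
    (l.map D.T).prod * x ∈ D.filt (d + l.length) := by
  induction l with
  | nil => simpa using hx
  | cons a l ih =>
    rw [List.map_cons, List.prod_cons, mul_assoc]
    exact T_mul_mem ih a

theorem perm_mem_filt (σ : Equiv.Perm (Fin n)) {d : ℕ} (hd : 0 < d) : D.ρ σ ∈ D.filt d := by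
  have := mono_mem_filt (D := D) (σ := σ) (l := []) (d := d) (by simpa using hd)
  simpa [mono] using this

theorem T_mem_filt (a : Fin n) {d : ℕ} (hd : 1 < d) : D.T a ∈ D.filt d := by
  have := mono_mem_filt (D := D) (σ := 1) (l := [a]) (d := d) (by simpa using hd)
  simpa [mono] using this

theorem sq_mem (a : Fin n) : D.T a * D.T a ∈ D.filt 2 := by
  rw [D.quad]
  refine add_mem (Submodule.smul_mem _ _ (T_mem_filt a (by omega))) (Submodule.smul_mem _ _ ?_)
  rw [← map_one D.ρ]
  exact perm_mem_filt 1 (by omega)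

theorem comm_mem (a b : Fin n) : D.T a * D.T b - D.T b * D.T a ∈ D.filt 2 := by
  by_cases h : a = b
  · subst h; simp
  · rw [D.comm a b h]
    exact sub_mem (mul_perm_mem (T_mem_filt b (by omega)) _)
      (perm_mul_mem (T_mem_filt b (by omega)) _)

/-- In the associated graded algebra a product of two distinct shifted generators absorbs their
transposition. -/
theorem fuse_mem {a b : Fin n} (h : a ≠ b) :
    D.T a * D.T b * D.ρ (Equiv.swap a b) - D.T a * D.T b ∈ D.filt 2 := by
  have e : D.T a * D.T b * D.ρ (Equiv.swap a b) - D.T a * D.T b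
      = D.T b - D.T b * D.ρ (Equiv.swap a b) := by
    have := D.fuse a b h
    rw [← sub_eq_zero, ← neg_eq_zero, ← this]
    noncomm_ring
  rw [e]
  exact sub_mem (T_mem_filt b (by omega)) (mul_perm_mem (T_mem_filt b (by omega)) _)

theorem prod_sub_prod_mem_of_perm {l l' : List (Fin n)} (h : l.Perm l') :
    (l.map D.T).prod - (l'.map D.T).prod ∈ D.filt l.length := by
  induction h with
  | nil => simp
  | cons a _ ih =>
    simp only [List.map_cons, List.prod_cons, ← mul_sub]
    exact T_mul_mem ih a
  | swap a b l =>
    simp only [List.map_cons, List.prod_cons, ← mul_assoc, ← sub_mul]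
    have := mul_prod_mem (D := D) (comm_mem b a) l
    exact filt_mono (by simp; omega) this
  | trans h₁ _ ih₁ ih₂ =>
    rw [← h₁.length_eq] at ih₂
    simpa using add_mem ih₁ ih₂

theorem mono_sub_mono_mem_of_perm (σ : Equiv.Perm (Fin n)) {l l' : List (Fin n)}
    (h : l.Perm l') : D.mono σ l - D.mono σ l' ∈ D.filt l.length := by
  rw [mono, mono, ← mul_sub]
  exact perm_mul_mem (prod_sub_prod_mem_of_perm h) σ

theorem _root_.List.Subperm.exists_perm_append {α : Type*} {l₁ l₂ : List α} (h : l₁.Subperm l₂) :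
    ∃ l, l₂.Perm (l₁ ++ l) := by
  obtain ⟨l', hp, hs⟩ := h
  obtain ⟨l, hl⟩ := hs.exists_perm_append
  exact ⟨l, hl.trans (hp.append_right l)⟩

theorem mono_mem_of_not_nodup (σ : Equiv.Perm (Fin n)) {l : List (Fin n)} (h : ¬ l.Nodup) :
    D.mono σ l ∈ D.filt l.length := by
  obtain ⟨a, ha⟩ := List.exists_duplicate_iff_not_nodup.mpr h
  obtain ⟨l', hl'⟩ := (List.duplicate_iff_sublist.mp ha).subperm.exists_perm_append
  have h1 := mono_sub_mono_mem_of_perm (D := D) σ hl'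
  have h2 : D.mono σ ([a, a] ++ l') ∈ D.filt l.length := by
    have := perm_mul_mem (mul_prod_mem (D := D) (sq_mem a) l') σ
    rw [hl'.length_eq]
    refine filt_mono (d := 2 + l'.length) (by simp; omega) ?_
    simpa [mono, mul_assoc] using this
  simpa using add_mem h1 h2

/-- Multiply `D.mono σ l` on the right by s = (a b). Reordering so that T_a T_b comes last, s is
absorbed modulo lower terms. Moving s to the left instead gives σ s times a reordering of the same
generators, as `l` is stable under s. -/
theorem mono_sub_mono_mul_swap_mem (σ : Equiv.Perm (Fin n)) {l : List (Fin n)} (hl : l.Nodup)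
    {a b : Fin n} (ha : a ∈ l) (hb : b ∈ l) (hab : a ≠ b) :
    D.mono σ l - D.mono (σ * Equiv.swap a b) l ∈ D.filt l.length := by
  set s := Equiv.swap a b with hs
  have hs' : s⁻¹ = s := Equiv.swap_inv a b
  have hmem : ∀ x, s x ∈ l ↔ x ∈ l := by
    intro x
    rw [hs, Equiv.swap_apply_def]
    split_ifs with h1 h2
    · subst h1; simp [ha, hb]
    · subst h2; simp [ha, hb]
    · rfl
  have hp : (l.map s).Perm l := by
    refine (List.perm_ext_iff_of_nodup (hl.map s.injective) hl).mpr fun x => ?_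
    rw [List.mem_map]
    constructor
    · rintro ⟨y, hy, rfl⟩; exact (hmem y).mpr hy
    · intro hx; exact ⟨s x, (hmem x).mpr hx, by simp [hs]⟩
  have hsub : [a, b].Subperm l := by
    refine List.subperm_of_subset (by simp [hab]) ?_
    simp [ha, hb]
  obtain ⟨l', hl'⟩ := hsub.exists_perm_append
  have hl2 : l.Perm (l' ++ [a, b]) := hl'.trans List.perm_append_comm
  have e1 := mono_sub_mono_mem_of_perm (D := D) σ hl2
  have e2 := mul_perm_mem e1 s
  have e3 : D.mono σ (l' ++ [a, b]) * D.ρ s - D.mono σ (l' ++ [a, b]) ∈ D.filt l.length := by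
    have := perm_mul_mem (prod_mul_mem (D := D) (fuse_mem hab) l') σ
    rw [hl2.length_eq]
    refine filt_mono (d := 2 + l'.length) (by simp; omega) ?_
    simpa [mono, mul_assoc, mul_sub] using this
  have e4 := mono_sub_mono_mem_of_perm (D := D) (σ * s) hp
  rw [List.length_map] at e4
  have e5 : D.mono σ l * D.ρ s = D.mono (σ * s) (l.map s) := by rw [mono_mul_perm, hs']
  rw [sub_mul, e5] at e2
  have := add_mem (sub_mem (sub_mem e1 e3) e2) e4
  convert this using 1
  abel

/-- Modulo products with less shifted generators, one can assume that the permutation is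
decreasing on the indices of these generators. -/
theorem exists_antitone (σ : Equiv.Perm (Fin n)) {l : List (Fin n)} (hl : l.Nodup) :
    ∃ τ : Equiv.Perm (Fin n), (∀ i ∈ l, ∀ j ∈ l, i < j → τ j < τ i) ∧
      D.mono σ l - D.mono τ l ∈ D.filt l.length := by
  classical
  -- By the rearrangement inequality, exchanging the values at i < j with τ i < τ j strictly lowers
  -- this sum. When i, j lie in `l` the exchange stays in the class of σ modulo lower terms, so a
  -- minimiser is decreasing on `l`.
  let f : Equiv.Perm (Fin n) → ℕ := fun τ => ∑ i : Fin n, (i : ℕ) * τ i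
  obtain ⟨τ, hτ, hmin⟩ := Finset.exists_min_image
    (Finset.univ.filter fun τ => D.mono σ l - D.mono τ l ∈ D.filt l.length) f
    ⟨σ, by simp⟩
  simp only [Finset.mem_filter, Finset.mem_univ, true_and] at hτ hmin
  refine ⟨τ, fun i hi j hj hij => ?_, hτ⟩
  by_contra hcon
  have hlt : τ i < τ j := lt_of_le_of_ne (not_lt.mp hcon) (τ.injective.ne hij.ne)
  have hmem := add_mem hτ (mono_sub_mono_mul_swap_mem (D := D) τ hl hi hj hij.ne)
  rw [sub_add_sub_cancel] at hmem
  have h1 := hmin _ hmem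
  have hj' : j ∈ Finset.univ.erase i := by simp [hij.ne']
  have split : ∀ g : Fin n → ℕ,
      ∑ x, g x = g i + (g j + ∑ x ∈ (Finset.univ.erase i).erase j, g x) := by
    intro g
    rw [Finset.add_sum_erase _ g hj', Finset.add_sum_erase _ g (Finset.mem_univ i)]
  have h2 : ∑ x ∈ (Finset.univ.erase i).erase j, (x : ℕ) * (τ * Equiv.swap i j) x
      = ∑ x ∈ (Finset.univ.erase i).erase j, (x : ℕ) * τ x := by
    refine Finset.sum_congr rfl fun x hx => ?_
    simp only [Finset.mem_erase, Finset.mem_univ, and_true] at hx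
    rw [Equiv.Perm.mul_apply, Equiv.swap_apply_of_ne_of_ne hx.2 hx.1]
  simp only [f] at h1
  rw [split, split fun x => (x : ℕ) * ((τ * Equiv.swap i j) x : ℕ), h2] at h1
  simp only [Equiv.Perm.mul_apply, Equiv.swap_apply_left, Equiv.swap_apply_right] at h1
  rw [Fin.lt_def] at hij hlt
  nlinarith

end FusedData

/-! ### The underlying permutation and the signs of a signed permutation -/

section Signed

variable {n : ℕ}

/-- The permutation of `{1, …, n}` underlying `ω` is `σ`, and `ω` takes negative values exactly at
the positions in `l`. -/
def IsSigned (ω : SignedPerm n) (σ : Equiv.Perm (Fin n)) (l : List (Fin n)) : Prop :=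
  ∀ i, (ω.1 (pos i)).1 = if i ∈ l then -((σ i : ℕ) + 1 : ℤ) else (σ i : ℕ) + 1

/-- The number of negative values of `ω` at positive numbers. -/
noncomputable def negCount (ω : SignedPerm n) : ℕ :=
  (Finset.univ.filter fun i => (ω.1 (pos i)).1 < 0).card

theorem IsSigned.neg_iff {ω : SignedPerm n} {σ : Equiv.Perm (Fin n)} {l : List (Fin n)}
    (h : IsSigned ω σ l) (i : Fin n) : (ω.1 (pos i)).1 < 0 ↔ i ∈ l := by
  rw [h i]; split_ifs with hi
  · simp only [hi, iff_true]; omega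
  · simp only [hi, iff_false]; omega

theorem IsSigned.abs_eq {ω : SignedPerm n} {σ : Equiv.Perm (Fin n)} {l : List (Fin n)}
    (h : IsSigned ω σ l) (i : Fin n) : |(ω.1 (pos i)).1| = (σ i : ℕ) + 1 := by
  rw [h i]; split_ifs <;> grind

theorem IsSigned.length_eq {ω : SignedPerm n} {σ : Equiv.Perm (Fin n)} {l : List (Fin n)}
    (h : IsSigned ω σ l) (hl : l.Nodup) : l.length = negCount ω := by
  rw [← List.toFinset_card_of_nodup hl, negCount]
  congr 1
  ext i
  simp [h.neg_iff]

theorem IsSigned.unique {ω : SignedPerm n} {σ σ' : Equiv.Perm (Fin n)} {l l' : List (Fin n)}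
    (h : IsSigned ω σ l) (h' : IsSigned ω σ' l') : σ = σ' ∧ ∀ i, i ∈ l ↔ i ∈ l' := by
  constructor
  · ext i
    have := h.abs_eq i
    rw [h'.abs_eq i] at this
    omega
  · intro i
    rw [← h.neg_iff, ← h'.neg_iff]

theorem eq_pos_or_neg (j : SignedSet n) : ∃ i : Fin n, j = pos i ∨ j = -pos i := by
  obtain ⟨j, h0, hj⟩ := j
  rw [abs_le] at hj
  refine ⟨⟨j.natAbs - 1, by omega⟩, ?_⟩
  rcases lt_or_gt_of_ne h0 with h | h
  · right; apply Subtype.ext; simp [pos]; omega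
  · left; apply Subtype.ext; simp [pos]; omega

theorem signedPerm_ext {ω ω' : SignedPerm n} (h : ∀ i, (ω.1 (pos i)).1 = (ω'.1 (pos i)).1) :
    ω = ω' := by
  apply Subtype.ext
  apply Equiv.ext
  intro j
  obtain ⟨i, rfl | rfl⟩ := eq_pos_or_neg j
  · exact Subtype.ext (h i)
  · rw [ω.2, ω'.2]
    exact congrArg _ (Subtype.ext (h i))

theorem IsSigned.ext {ω ω' : SignedPerm n} {σ : Equiv.Perm (Fin n)} {l l' : List (Fin n)}
    (h : IsSigned ω σ l) (h' : IsSigned ω' σ l') (hl : ∀ i, i ∈ l ↔ i ∈ l') : ω = ω' :=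
  signedPerm_ext fun i => by rw [h i, h' i]; simp only [hl]

theorem isSigned_one : IsSigned (1 : SignedPerm n) 1 [] := fun i => by
  change (pos i).1 = _
  simp [pos]

theorem tau_pos {i : Fin n} (hi : (i : ℕ) ≠ 0) (j : Fin n) :
    (tau i).1 (pos j) = pos (adjSwap n i j) := by
  apply Subtype.ext
  rw [tau_val, adjSwap_of_lt (by omega) i.2]
  simp only [tauFun, pos, Equiv.swap_apply_def, Fin.ext_iff]
  grind

theorem tau_zero_pos (hn : 0 < n) (j : Fin n) :
    (tau ⟨0, hn⟩).1 (pos j) = if j = ⟨0, hn⟩ then -pos j else pos j := by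
  apply Subtype.ext
  rw [tau_val]
  split_ifs with h
  · simp [tauFun, pos, h]
  · have hj : (j : ℕ) ≠ 0 := fun e => h (Fin.ext e)
    simp only [tauFun, pos, if_true]
    grind

/-- The pair (σ, l) changes exactly as in `FusedData.mono_mul_perm`; this is what makes leading
terms follow signed permutations. -/
theorem IsSigned.mul_tau {ω : SignedPerm n} {σ : Equiv.Perm (Fin n)} {l : List (Fin n)}
    (h : IsSigned ω σ l) {i : Fin n} (hi : (i : ℕ) ≠ 0) :
    IsSigned (ω * tau i) (σ * adjSwap n i) (l.map ⇑(adjSwap n i)⁻¹) := by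
  intro j
  change (ω.1 ((tau i).1 (pos j))).1 = _
  rw [tau_pos hi, h, Equiv.Perm.mul_apply]
  have : j ∈ l.map ⇑(adjSwap n i)⁻¹ ↔ adjSwap n i j ∈ l := by
    rw [List.mem_map]
    constructor
    · rintro ⟨x, hx, rfl⟩; rwa [perm_apply_inv]
    · intro hx; exact ⟨_, hx, (adjSwap n i).symm_apply_apply j⟩
  simp only [this]

theorem IsSigned.mul_tau_zero {ω : SignedPerm n} {σ : Equiv.Perm (Fin n)} {l : List (Fin n)}
    (h : IsSigned ω σ l) (hn : 0 < n) (h0 : ⟨0, hn⟩ ∉ l) :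
    IsSigned (ω * tau ⟨0, hn⟩) σ (l ++ [⟨0, hn⟩]) := by
  intro j
  change (ω.1 ((tau ⟨0, hn⟩).1 (pos j))).1 = _
  rw [tau_zero_pos]
  split_ifs with h1 h2 h2
  · rw [ω.2, SignedSet.coe_neg, h j, if_neg (h1 ▸ h0)]
  · simp [h1] at h2
  · rw [h j, if_pos]
    simpa [h1] using h2
  · rw [h j, if_neg]
    intro hj
    simp [hj] at h2

/-- The map `± i ↦ ± τ i` on `{-n, …, -1, 1, …, n}`, with the sign changed for `i` in `l`. -/
def liftFun (τ : Equiv.Perm (Fin n)) (l : List (Fin n)) (j : SignedSet n) : SignedSet n :=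
  if 0 < j.1 ↔ (⟨j.1.natAbs - 1, by have := abs_le.mp j.2.2; have := j.2.1; omega⟩ : Fin n) ∉ l then
    pos (τ ⟨j.1.natAbs - 1, by have := abs_le.mp j.2.2; have := j.2.1; omega⟩)
  else -pos (τ ⟨j.1.natAbs - 1, by have := abs_le.mp j.2.2; have := j.2.1; omega⟩)

theorem liftFun_pos (τ : Equiv.Perm (Fin n)) (l : List (Fin n)) (i : Fin n) :
    liftFun τ l (pos i) = if i ∈ l then -pos (τ i) else pos (τ i) := by
  have e : (⟨(pos i).1.natAbs - 1, by simp [pos]; omega⟩ : Fin n) = i := by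
    apply Fin.ext; simp [pos]; omega
  have h0 : 0 < (pos i).1 := by simp only [pos]; omega
  simp only [liftFun, e, h0, true_iff]
  split_ifs <;> rfl

theorem liftFun_neg (τ : Equiv.Perm (Fin n)) (l : List (Fin n)) (j : SignedSet n) :
    liftFun τ l (-j) = -liftFun τ l j := by
  have h0 : 0 < -j.1 ↔ ¬ 0 < j.1 := by
    have := j.2.1
    omega
  have hneg : ∀ x : SignedSet n, - -x = x := fun x => Subtype.ext (neg_neg x.1)
  simp only [liftFun, SignedSet.coe_neg, h0, Int.natAbs_neg]
  by_cases h1 : 0 < j.1 <;>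
  by_cases h2 : (⟨j.1.natAbs - 1, by have := abs_le.mp j.2.2; have := j.2.1; omega⟩ : Fin n) ∈ l <;>
  simp [h1, h2, hneg]

theorem exists_isSigned (σ : Equiv.Perm (Fin n)) (l : List (Fin n)) :
    ∃ ω : SignedPerm n, IsSigned ω σ l := by
  have hinj : Function.Injective (liftFun σ l) := by
    have hneg : ∀ x y : SignedSet n, -x = y ↔ x = -y := fun x y => by
      constructor
      · rintro rfl; exact Subtype.ext (neg_neg x.1).symm
      · rintro rfl; exact Subtype.ext (neg_neg y.1)
    have hpos : ∀ i j : Fin n, pos i = pos j → i = j := fun i j h => by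
      have := congrArg Subtype.val h
      apply Fin.ext
      simp only [pos] at this
      omega
    have hpn : ∀ i j : Fin n, pos i ≠ -pos j := fun i j h => by
      have := congrArg Subtype.val h
      simp only [pos, SignedSet.coe_neg] at this
      omega
    have hpn' : ∀ i j : Fin n, -pos i ≠ pos j := fun i j h => hpn i j ((hneg _ _).mp h)
    have hnn : ∀ i j : Fin n, -pos i = -pos j → i = j := fun i j h => by
      have h2 := (hneg _ _).mp h
      rw [(hneg (-pos j) (pos j)).mpr rfl] at h2
      exact hpos i j h2
    have key : ∀ i j, liftFun σ l (pos i) = liftFun σ l (pos j) → i = j := by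
      intro i j h
      rw [liftFun_pos, liftFun_pos] at h
      split_ifs at h
      · exact σ.injective (hnn _ _ h)
      · exact absurd h (hpn' _ _)
      · exact absurd h (hpn _ _)
      · exact σ.injective (hpos _ _ h)
    have key2 : ∀ i j, liftFun σ l (pos i) ≠ -liftFun σ l (pos j) := by
      intro i j h
      rw [liftFun_pos, liftFun_pos] at h
      have nn : - -pos (σ j) = pos (σ j) := (hneg _ _).mpr rfl
      split_ifs at h with h1 h2 h2
      · rw [nn] at h; exact hpn' _ _ h
      · rw [σ.injective (hnn _ _ h)] at h1; exact h2 h1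
      · rw [nn] at h; rw [σ.injective (hpos _ _ h)] at h1; exact h1 h2
      · exact hpn _ _ h
    intro x y hxy
    obtain ⟨i, rfl | rfl⟩ := eq_pos_or_neg x <;> obtain ⟨j, rfl | rfl⟩ := eq_pos_or_neg y
    · rw [key i j hxy]
    · rw [liftFun_neg] at hxy; exact absurd hxy (key2 i j)
    · rw [liftFun_neg, hneg] at hxy; exact absurd hxy (key2 i j)
    · rw [liftFun_neg, liftFun_neg, hneg, (hneg _ (liftFun σ l (pos j))).mpr rfl] at hxy
      rw [key i j hxy]
  refine ⟨⟨Equiv.ofBijective _ (Finite.injective_iff_bijective.mp hinj), liftFun_neg σ l⟩, ?_⟩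
  intro i
  change (liftFun σ l (pos i)).1 = _
  rw [liftFun_pos]
  split_ifs <;> simp [pos]

theorem IsSigned.avoids {ω : SignedPerm n} {σ : Equiv.Perm (Fin n)} {l : List (Fin n)}
    (h : IsSigned ω σ l) (hσ : ∀ i ∈ l, ∀ j ∈ l, i < j → σ j < σ i) : Avoids ω := by
  intro i j hij hi hj
  rw [h.neg_iff] at hi hj
  have := hσ i hi j hj hij
  rw [h.abs_eq, h.abs_eq]
  rw [Fin.lt_def] at this
  omega

theorem IsSigned.antitone {ω : SignedPerm n} {σ : Equiv.Perm (Fin n)} {l : List (Fin n)}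
    (h : IsSigned ω σ l) (hω : Avoids ω) : ∀ i ∈ l, ∀ j ∈ l, i < j → σ j < σ i := by
  intro i hi j hj hij
  have := hω i j hij ((h.neg_iff i).mpr hi) ((h.neg_iff j).mpr hj)
  rw [h.abs_eq, h.abs_eq] at this
  rw [Fin.lt_def]
  omega

/-- The permutation σ⁻¹ σ' fixes the complement of `l` and is strictly increasing on `l`; a strictly
increasing self-map of a finite chain is the identity. -/
theorem perm_eq_of_antitone {σ σ' : Equiv.Perm (Fin n)} {l : List (Fin n)}
    (hσ : ∀ i ∈ l, ∀ j ∈ l, i < j → σ j < σ i) (hσ' : ∀ i ∈ l, ∀ j ∈ l, i < j → σ' j < σ' i)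
    (hl : ∀ i ∈ l, σ⁻¹ (σ' i) ∈ l) (hfix : ∀ i ∉ l, σ⁻¹ (σ' i) = i) : σ = σ' := by
  let f : {i // i ∈ l} → {i // i ∈ l} := fun i => ⟨σ⁻¹ (σ' i), hl i i.2⟩
  have hf : StrictMono f := by
    intro i j hij
    by_contra hcon
    have h1 : f j ≤ f i := not_lt.mp hcon
    have h2 : σ' j < σ' i := hσ' i i.2 j j.2 hij
    rcases h1.lt_or_eq with h | h
    · have h3 := hσ _ (f j).2 _ (f i).2 h
      simp only [f, perm_apply_inv] at h3
      exact lt_asymm h2 h3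
    · have h3 := congrArg (fun x => σ x.1) h
      simp only [f, perm_apply_inv] at h3
      exact h2.ne h3
  ext i
  by_cases hi : i ∈ l
  · have h1 : f ⟨i, hi⟩ = ⟨i, hi⟩ := le_antisymm hf.apply_le hf.le_apply
    have h2 := congrArg (fun x => σ x.1) h1
    simp only [f, perm_apply_inv] at h2
    rw [h2]
  · have h2 := congrArg σ (hfix i hi)
    rw [perm_apply_inv] at h2
    rw [h2]

end Signed

/-! ### Leading terms of the normal forms -/

section Words

variable {M : Type*} [Monoid M] {n : ℕ}

theorem desc_one_eq (g : Fin n → M) (m : Fin n) :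
    desc g m 1 = ((List.ofFn fun t : Fin m => (⟨m - t, by omega⟩ : Fin n)).map g).prod := by
  rw [List.map_ofFn]
  rfl

theorem desc_succ_eq (g : Fin n → M) (m : Fin n) (a : ℕ) :
    desc g m (a + 1)
      = ((List.ofFn fun t : Fin (m + 1 - (a + 1)) => (⟨m - t, by omega⟩ : Fin n)).map g).prod := by
  rw [List.map_ofFn]
  rfl

theorem desc_zero_eq (g : Fin n → M) (m : Fin n) :
    desc g m 0 = desc g m 1 * g ⟨0, m.pos⟩ := by
  unfold desc
  rw [List.ofFn_succ', List.concat_eq_append, List.prod_append, List.prod_singleton]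
  congr 2
  simp

theorem asc_eq (g : Fin n → M) (m : Fin n) (j : Fin (m + 1)) :
    asc g m j = ((List.ofFn fun t : Fin j => (⟨t + 1, by omega⟩ : Fin n)).map g).prod := by
  rw [List.map_ofFn]
  rfl

/-- The number of labels `true` among the first `k` labels of a normal form. -/
def trueCount (c : NormalForm n) : (k : ℕ) → k ≤ n → ℕ
  | 0, _ => 0
  | k + 1, h => trueCount c k (Nat.le_of_succ_le h) + if (c ⟨k, h⟩).1 then 1 else 0

theorem trueCount_le (c : NormalForm n) (k : ℕ) (hk : k ≤ n) : trueCount c k hk ≤ k := by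
  induction k with
  | zero => rfl
  | succ k ih =>
    have := ih (Nat.le_of_succ_le hk)
    rw [trueCount]; split_ifs <;> omega

theorem trueCount_eq_iff (c : NormalForm n) (k : ℕ) (hk : k ≤ n) :
    trueCount c k hk = k ↔ ∀ m : Fin n, (m : ℕ) < k → (c m).1 = true := by
  induction k with
  | zero => simp [trueCount]
  | succ k ih =>
    have h1 := trueCount_le c k (Nat.le_of_succ_le hk)
    have h2 := ih (Nat.le_of_succ_le hk)
    rw [trueCount]
    constructor
    · intro h m hm
      split_ifs at h with h3
      · by_cases hmk : (m : ℕ) = k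
        · have : m = ⟨k, hk⟩ := Fin.ext hmk
          rwa [this]
        · exact h2.mp (by omega) m (by omega)
      · omega
    · intro h
      rw [if_pos (h ⟨k, hk⟩ (Nat.lt_succ_self k)), h2.mpr fun m hm => h m (by omega)]

end Words

namespace FusedData

variable {n : ℕ} {k : ℂ} {B : Type*} [Ring B] [Algebra ℂ B] (D : FusedData n k B)

/-- The leading term of `a` is the permutation underlying `ω` times the product of the `m` shifted
generators at the positions where `ω` is negative. -/
def HasLeading (ω : SignedPerm n) (a : B) (m : ℕ) : Prop :=
  ∃ σ l, IsSigned ω σ l ∧ l.Nodup ∧ l.length = m ∧ a - D.mono σ l ∈ D.filt m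

/-- The family `g 0, …, g (n-1)` consists of a shifted generator and adjacent transpositions. -/
structure IsLetter (g : Fin n → B) (c : ℂ) : Prop where
  zero : ∀ hn : 0 < n, g ⟨0, hn⟩ = D.T ⟨0, hn⟩ + c • 1
  pos : ∀ i : Fin n, (i : ℕ) ≠ 0 → g i = D.ρ (adjSwap n i)

variable {D}

theorem hasLeading_one : D.HasLeading 1 1 0 := by
  refine ⟨1, [], isSigned_one, List.nodup_nil, rfl, ?_⟩
  simp [mono]

theorem HasLeading.eq_negCount {ω : SignedPerm n} {a : B} {m : ℕ} (h : D.HasLeading ω a m) :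
    m = negCount ω := by
  obtain ⟨σ, l, h1, h2, rfl, -⟩ := h
  exact h1.length_eq h2

theorem HasLeading.mem_filt {ω : SignedPerm n} {a : B} {m : ℕ} (h : D.HasLeading ω a m) :
    a ∈ D.filt (m + 1) := by
  obtain ⟨σ, l, -, -, hl, h⟩ := h
  rw [← sub_add_cancel a (D.mono σ l)]
  exact add_mem (filt_mono (Nat.le_succ m) h) (mono_mem_filt (by omega))

variable {g : Fin n → B} {c : ℂ}

theorem HasLeading.mul_tau (hg : D.IsLetter g c) {ω : SignedPerm n} {a : B} {m : ℕ} (h : D.HasLeading ω a m)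
    {i : Fin n} (hi : (i : ℕ) ≠ 0) : D.HasLeading (ω * tau i) (a * g i) m := by
  obtain ⟨σ, l, h1, h2, h3, h4⟩ := h
  refine ⟨_, _, h1.mul_tau hi, h2.map (Equiv.injective _), by simpa using h3, ?_⟩
  rw [hg.pos i hi, ← mono_mul_perm, ← sub_mul]
  exact mul_perm_mem h4 _

/-- Positivity of ω(1) says that T_0 does not yet occur, so the degree really rises by one and no
square appears. The constant `c` only contributes in the old degree. -/
theorem HasLeading.mul_tau_zero (hg : D.IsLetter g c) {ω : SignedPerm n} {a : B} {m : ℕ} (h : D.HasLeading ω a m)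
    (hn : 0 < n) (h0 : 0 < (ω.1 (FusedHecke.pos ⟨0, hn⟩)).1) :
    D.HasLeading (ω * tau ⟨0, hn⟩) (a * g ⟨0, hn⟩) (m + 1) := by
  have ha := h.mem_filt
  obtain ⟨σ, l, h1, h2, h3, h4⟩ := h
  have hl : ⟨0, hn⟩ ∉ l := fun hl => by
    have := (h1.neg_iff _).mpr hl
    omega
  refine ⟨_, _, h1.mul_tau_zero hn hl, ?_, by simpa using h3, ?_⟩
  · exact List.nodup_append.mpr ⟨h2, by simp, fun a ha b hb => by
      rw [List.mem_singleton.mp hb]; rintro rfl; exact hl ha⟩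
  · rw [hg.zero hn, ← mono_mul_T, mul_add, mul_smul_comm, mul_one, add_sub_right_comm, ← sub_mul]
    exact add_mem (mul_T_mem h4 _) (Submodule.smul_mem _ _ ha)

theorem HasLeading.mul_list (hg : D.IsLetter g c) {ω : SignedPerm n} {a : B} {m : ℕ} (h : D.HasLeading ω a m)
    (L : List (Fin n)) (hL : ∀ i ∈ L, (i : ℕ) ≠ 0) :
    D.HasLeading (ω * (L.map tau).prod) (a * (L.map g).prod) m := by
  induction L generalizing ω a with
  | nil => simpa using h
  | cons i L ih =>
    simp only [List.map_cons, List.prod_cons, ← mul_assoc]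
    exact ih (h.mul_tau hg (hL i (by simp))) fun j hj => hL j (by simp [hj])

theorem HasLeading.mul_factor (hg : D.IsLetter g c) {ω : SignedPerm n} {a : B} {q : ℕ} (h : D.HasLeading ω a q)
    (m : Fin n) (hω : ω ∈ fixing n m) (d : Bool × Fin (m + 1)) :
    D.HasLeading (ω * factor tau m d) (a * factor g m d) (q + if d.1 then 1 else 0) := by
  obtain ⟨b, j⟩ := d
  cases b
  · simp only [factor, Bool.false_eq_true, if_false, add_zero, desc_succ_eq]
    refine h.mul_list hg _ fun i hi => ?_
    obtain ⟨t, rfl⟩ := (List.mem_ofFn' _ _).mp hi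
    have := t.2
    simp only
    omega
  · simp only [factor, if_true, asc_eq, desc_zero_eq, ← mul_assoc]
    refine HasLeading.mul_list hg ?_ _ fun i hi => ?_
    · refine HasLeading.mul_tau_zero hg ?_ _ ?_
      · rw [desc_one_eq, desc_one_eq]
        refine h.mul_list hg _ fun i hi => ?_
        obtain ⟨t, rfl⟩ := (List.mem_ofFn' _ _).mp hi
        have := t.2
        simp only
        omega
      -- The product τ_m ⋯ τ_1 sends 1 to m + 1, which ω fixes since it lies in `fixing n m`; hence
      -- the value at 1 is positive when the letter `g 0` is reached.
      · change 0 < (ω.1 ((desc tau m 1).1 (FusedHecke.pos ⟨0, _⟩))).1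
        have e : ((desc tau m 1).1 (FusedHecke.pos ⟨0, m.pos⟩)).1 = (m : ℤ) + 1 :=
          desc_apply m m le_rfl _ (by simp [FusedHecke.pos])
        rw [hω _ (by rw [e]; grind), e]
        omega
    · obtain ⟨t, rfl⟩ := (List.mem_ofFn' _ _).mp hi
      simp

theorem hasLeading_partialProd (hg : D.IsLetter g c) (d : NormalForm n) (q : ℕ) (hq : q ≤ n) :
    D.HasLeading (partialProd tau d q hq) (partialProd g d q hq) (trueCount d q hq) := by
  induction q with
  | zero => exact hasLeading_one
  | succ q ih =>
    exact (ih (Nat.le_of_succ_le hq)).mul_factor hg ⟨q, hq⟩ (partialProd_mem d q _) _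

theorem hasLeading_normalProd (hg : D.IsLetter g c) (ω : SignedPerm n) :
    D.HasLeading ω (normalProd g (normalForm ω)) (trueCount (normalForm ω) n le_rfl) := by
  have := hasLeading_partialProd hg (normalForm ω) n le_rfl
  have e : partialProd tau (normalForm ω) n le_rfl = ω :=
    (Equiv.ofBijective _ normalProd_bijective).apply_symm_apply ω
  rwa [e] at this

/-- A purely combinatorial equality, read off from the degree of the leading term of any family of
letters. -/
theorem negCount_eq_trueCount (hg : D.IsLetter g c) (ω : SignedPerm n) :
    negCount ω = trueCount (normalForm ω) n le_rfl :=
  (hasLeading_normalProd hg ω).eq_negCount.symm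

/-- Every normal form is, modulo lower terms, the normal form of a signed permutation that avoids
the pattern. -/
theorem exists_avoids_mono (hg : D.IsLetter g c) (σ : Equiv.Perm (Fin n)) {l : List (Fin n)} (hl : l.Nodup) :
    ∃ ω : SignedPerm n, Avoids ω ∧ negCount ω = l.length ∧
      D.mono σ l - normalProd g (normalForm ω) ∈ D.filt l.length := by
  obtain ⟨τ, hτ, hmem⟩ := exists_antitone (D := D) σ hl
  obtain ⟨ω, hω⟩ := exists_isSigned τ l
  -- The leading monomial of the normal form of ω has the same permutation τ and a reordering `l'`
  -- of `l`; reordering costs only lower terms.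
  obtain ⟨σ', l', h1, h2, h3, h4⟩ := hasLeading_normalProd hg ω
  obtain ⟨rfl, hmem'⟩ := hω.unique h1
  have hp : l.Perm l' := (List.perm_ext_iff_of_nodup hl h2).mpr hmem'
  refine ⟨ω, hω.avoids hτ, (hω.length_eq hl).symm, ?_⟩
  rw [← h3, ← hp.length_eq] at h4
  have := sub_mem (add_mem hmem (mono_sub_mono_mem_of_perm (D := D) τ hp)) h4
  convert this using 1
  abel

/-- Triangularity: a monomial with a repeated index drops in degree, and any other is the normal
form of an avoiding ω up to lower degree. -/
theorem filt_le_span (hg : D.IsLetter g c) (d : ℕ) :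
    D.filt d ≤ Submodule.span ℂ {x | ∃ ω : SignedPerm n, Avoids ω ∧ negCount ω < d ∧
      x = normalProd g (normalForm ω)} := by
  induction d with
  | zero =>
    refine Submodule.span_le.mpr ?_
    rintro _ ⟨σ, l, hl, -⟩
    omega
  | succ d ih =>
    have up : ∀ e, e ≤ d → D.filt e ≤ Submodule.span ℂ {x | ∃ ω : SignedPerm n, Avoids ω ∧
        negCount ω < d + 1 ∧ x = normalProd g (normalForm ω)} := by
      intro e he
      refine (filt_mono he).trans (ih.trans (Submodule.span_mono ?_))
      rintro _ ⟨ω, h1, h2, rfl⟩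
      exact ⟨ω, h1, by omega, rfl⟩
    refine Submodule.span_le.mpr ?_
    rintro _ ⟨σ, l, hl, rfl⟩
    by_cases hnd : l.Nodup
    · obtain ⟨ω, h1, h2, h3⟩ := exists_avoids_mono hg σ hnd
      rw [← sub_add_cancel (D.mono σ l) (normalProd g (normalForm ω))]
      exact add_mem (up _ (by omega) h3) (Submodule.subset_span ⟨ω, h1, by omega, rfl⟩)
    · exact up _ (by omega) (mono_mem_of_not_nodup σ hnd)

end FusedData

/-! ### A representation on functions of words -/

section Rep

variable {n : ℕ} {Ω : Type*}

/-- The action of a permutation on functions of words. -/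
def repPerm (n : ℕ) (Ω : Type*) : Equiv.Perm (Fin n) →* Module.End ℂ ((Fin n → Ω) → ℂ) where
  toFun σ := LinearMap.funLeft ℂ ℂ fun w => w ∘ σ
  map_one' := rfl
  map_mul' _ _ := rfl

theorem repPerm_apply (σ : Equiv.Perm (Fin n)) (f : (Fin n → Ω) → ℂ) (w : Fin n → Ω) :
    repPerm n Ω σ f w = f (w ∘ σ) := rfl

theorem update_comp_swap {a b : Fin n} (hab : a ≠ b) (w : Fin n → Ω) (x y : Ω) :
    Function.update (Function.update w a x) b y ∘ Equiv.swap a b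
      = Function.update (Function.update w a y) b x := by
  funext i
  simp only [Function.comp_apply, Equiv.swap_apply_def, Function.update_apply]
  grind

theorem update_right_eq (b a : Fin n) (w : Fin n → Ω) (y : Ω) :
    Function.update w b y = Function.update (Function.update w a (w a)) b y := by
  rw [Function.update_eq_self]

variable [Fintype Ω]

/-- The weighted sum of the values of `u` at the letters, diminished by those in the word `w`. -/
def wordSum (wt : Ω → ℂ) (w : Fin n → Ω) (u : Ω → ℂ) : ℂ := ∑ m, wt m * u m - ∑ j, u (w j)

variable (wt : Ω → ℂ)

theorem wordSum_sub (w : Fin n → Ω) (u v : Ω → ℂ) :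
    wordSum wt w (fun m => u m - v m) = wordSum wt w u - wordSum wt w v := by
  simp only [wordSum, mul_sub, Finset.sum_sub_distrib]; ring

theorem wordSum_add (w : Fin n → Ω) (u v : Ω → ℂ) :
    wordSum wt w (fun m => u m + v m) = wordSum wt w u + wordSum wt w v := by
  simp only [wordSum, mul_add, Finset.sum_add_distrib]; ring

theorem wordSum_mul (w : Fin n → Ω) (c : ℂ) (u : Ω → ℂ) :
    wordSum wt w (fun m => c * u m) = c * wordSum wt w u := by
  simp only [wordSum, mul_sub, Finset.mul_sum, mul_left_comm]

/-- The n places of the word use up n of the total weight n + k; this is how `k` enters the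
quadratic relation of the representation. -/
theorem wordSum_const {k : ℂ} (hk : ∑ m, wt m = n + k) (w : Fin n → Ω) (c : ℂ) :
    wordSum wt w (fun _ => c) = k * c := by
  simp only [wordSum, ← Finset.sum_mul, hk, Finset.sum_const, Finset.card_univ, Fintype.card_fin,
    nsmul_eq_mul]
  ring

theorem wordSum_update (w : Fin n → Ω) (i : Fin n) (m : Ω) (u : Ω → ℂ) :
    wordSum wt (Function.update w i m) u = wordSum wt w u - u m + u (w i) := by
  have e : ∀ v : Fin n → Ω, ∑ j, u (v j) = u (v i) + ∑ j ∈ Finset.univ.erase i, u (v j) :=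
    fun v => (Finset.add_sum_erase _ _ (Finset.mem_univ i)).symm
  have h : ∑ j ∈ Finset.univ.erase i, u (Function.update w i m j)
      = ∑ j ∈ Finset.univ.erase i, u (w j) := by
    refine Finset.sum_congr rfl fun j hj => ?_
    rw [Function.update_of_ne (Finset.ne_of_mem_erase hj)]
  simp only [wordSum]
  rw [e, e w, h, Function.update_self]
  ring

theorem wordSum_comp (w : Fin n → Ω) (σ : Equiv.Perm (Fin n)) (u : Ω → ℂ) :
    wordSum wt (w ∘ σ) u = wordSum wt w u := by
  simp only [wordSum, Function.comp_apply]
  rw [Equiv.sum_comp σ fun j => u (w j)]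

theorem wordSum_wordSum_comm (w : Fin n → Ω) (u : Ω → Ω → ℂ) :
    wordSum wt w (fun m => wordSum wt w fun m' => u m m')
      = wordSum wt w (fun m' => wordSum wt w fun m => u m m') := by
  simp only [wordSum, mul_sub, Finset.mul_sum, Finset.sum_sub_distrib]
  rw [Finset.sum_comm, Finset.sum_comm (f := fun j i => u (w j) (w i)),
    Finset.sum_comm (f := fun j m => wt m * u (w j) m),
    Finset.sum_comm (f := fun m j => wt m * u m (w j))]
  simp only [mul_left_comm]
  ring

/-- The action of a shifted generator on functions of words. -/
def repT (a : Fin n) : Module.End ℂ ((Fin n → Ω) → ℂ) where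
  toFun f w := wordSum wt w fun m => f (Function.update w a m)
  map_add' _ _ := funext fun w => wordSum_add wt w _ _
  map_smul' c _ := funext fun w => wordSum_mul wt w c _

theorem repT_apply (a : Fin n) (f : (Fin n → Ω) → ℂ) (w : Fin n → Ω) :
    repT wt a f w = wordSum wt w fun m => f (Function.update w a m) := rfl

/-- The inner sum is taken relative to the word already changed at `a`, where one occurrence of `w
a` has become `m`; this produces the two correction terms. -/
theorem repT_repT_apply (a b : Fin n) (f : (Fin n → Ω) → ℂ) (w : Fin n → Ω) :
    repT wt a (repT wt b f) w
      = wordSum wt w (fun m => wordSum wt w fun m' =>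
          f (Function.update (Function.update w a m) b m'))
        - wordSum wt w (fun m => f (Function.update (Function.update w a m) b m))
        + wordSum wt w (fun m => f (Function.update (Function.update w a m) b (w a))) := by
  rw [repT_apply, ← wordSum_sub, ← wordSum_add]
  congr 1
  funext m
  rw [repT_apply, wordSum_update]

/-- The representation on functions of words. -/
def repData {k : ℂ} (hk : ∑ m, wt m = n + k) :
    FusedData n k (Module.End ℂ ((Fin n → Ω) → ℂ)) where
  ρ := repPerm n Ω
  T := repT wt
  conj σ a := by
    refine LinearMap.ext fun f => funext fun w => ?_
    change wordSum wt (w ∘ σ) (fun m => f (Function.update (w ∘ σ) a m))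
      = wordSum wt w (fun m => f (Function.update w (σ a) m ∘ σ))
    rw [wordSum_comp]
    congr 1
    funext m
    rw [Function.update_comp_eq_of_injective _ σ.injective]
  quad a := by
    refine LinearMap.ext fun f => funext fun w => ?_
    change wordSum wt w (fun m => wordSum wt (Function.update w a m) fun m' =>
      f (Function.update (Function.update w a m) a m'))
        = (k - 1) * wordSum wt w (fun m => f (Function.update w a m)) + k * f w
    simp only [Function.update_idem, wordSum_update, Function.update_eq_self, wordSum_add,
      wordSum_sub, wordSum_const wt hk]
    ring
  comm a b hab := by
    refine LinearMap.ext fun f => funext fun w => ?_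
    change repT wt a (repT wt b f) w - repT wt b (repT wt a f) w
      = wordSum wt w (fun m => f (Function.update w b m ∘ Equiv.swap a b))
        - wordSum wt (w ∘ Equiv.swap a b) (fun m => f (Function.update (w ∘ Equiv.swap a b) b m))
    rw [repT_repT_apply, repT_repT_apply, wordSum_comp]
    simp only [Function.update_comm hab.symm]
    rw [wordSum_wordSum_comm wt w
      fun m m' => f (Function.update (Function.update w a m) b m')]
    have e1 : ∀ m, Function.update w b m ∘ Equiv.swap a b
        = Function.update (Function.update w a m) b (w a) := fun m => by
      rw [update_right_eq b a, update_comp_swap hab]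
    have e2 : ∀ m, Function.update (w ∘ Equiv.swap a b) b m
        = Function.update (Function.update w a (w b)) b m := fun m => by
      funext i
      simp only [Function.comp_apply, Equiv.swap_apply_def, Function.update_apply]
      grind
    simp only [e1, e2]
    ring
  fuse a b hab := by
    refine LinearMap.ext fun f => funext fun w => ?_
    -- The function (1 - s) f changes sign when places a and b are exchanged. So in T_a T_b h the
    -- double sum and the diagonal term vanish, and the remaining correction term cancels T_b h.
    set h : (Fin n → Ω) → ℂ := f - repPerm n Ω (Equiv.swap a b) f with hh
    have anti : ∀ x y, h (Function.update (Function.update w a x) b y)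
        = - h (Function.update (Function.update w a y) b x) := fun x y => by
      simp only [hh, Pi.sub_apply, repPerm_apply, update_comp_swap hab]
      ring
    change repT wt a (repT wt b h) w + repT wt b h w = 0
    rw [repT_repT_apply, repT_apply]
    have diag : ∀ x, h (Function.update (Function.update w a x) b x) = 0 := fun x =>
      self_eq_neg.mp (anti x x)
    have e1 : ∀ m, h (Function.update w b m)
        = -1 * h (Function.update (Function.update w a m) b (w a)) := fun m => by
      rw [update_right_eq b a, anti]; ring
    have e2 : wordSum wt w (fun m => wordSum wt w fun m' =>
        h (Function.update (Function.update w a m) b m')) = 0 := by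
      refine self_eq_neg.mp ?_
      conv_lhs => rw [wordSum_wordSum_comm]
      rw [neg_eq_neg_one_mul, ← wordSum_mul]
      congr 1
      funext m
      rw [← wordSum_mul]
      congr 1
      funext m'
      rw [anti]; ring
    have e3 : wordSum wt w (fun _ => (0 : ℂ)) = 0 := by
      simpa using wordSum_mul wt w 0 fun _ => 0
    simp only [diag, e1, wordSum_mul, e2, e3]
    ring

end Rep

/-! ### Linear independence -/

section Independent

variable {n : ℕ}

/-- The number of empty places of a word. -/
def emptyCount (w : Fin n → Option (Fin n)) : ℕ := (Finset.univ.filter fun i => w i = none).card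

/-- The word with the letter `i` at each place `i` which is not in `l`, and empty elsewhere. -/
def stdWord (l : List (Fin n)) (i : Fin n) : Option (Fin n) := if i ∈ l then none else some i

/-- The weights `1` for letters and `k` for the empty place. -/
def letterWeight (n : ℕ) (k : ℂ) : Option (Fin n) → ℂ := fun m => m.elim k fun _ => 1

theorem sum_letterWeight (n : ℕ) (k : ℂ) : ∑ m, letterWeight n k m = n + k := by
  simp [letterWeight, Fintype.sum_option, add_comm]

/-- The indicator function of the word `1 2 … n`. -/
noncomputable def stdIndicator (n : ℕ) : (Fin n → Option (Fin n)) → ℂ :=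
  fun w => if w = stdWord [] then 1 else 0

theorem emptyCount_stdWord {l : List (Fin n)} (hl : l.Nodup) :
    emptyCount (stdWord l) = l.length := by
  rw [← List.toFinset_card_of_nodup hl, emptyCount]
  congr 1
  ext i
  simp [stdWord]

theorem emptyCount_comp (w : Fin n → Option (Fin n)) (σ : Equiv.Perm (Fin n)) :
    emptyCount (w ∘ σ) = emptyCount w := by
  unfold emptyCount
  exact Finset.card_equiv σ fun i => by simp

theorem emptyCount_le_update (w : Fin n → Option (Fin n)) (a : Fin n) (m : Option (Fin n)) :
    emptyCount w ≤ emptyCount (Function.update w a m) + 1 := by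
  unfold emptyCount
  refine (Finset.card_le_card (t := insert a (Finset.univ.filter fun i =>
    Function.update w a m i = none)) fun i hi => ?_).trans (Finset.card_insert_le _ _)
  by_cases h : i = a
  · simp [h]
  · simpa [h] using hi

theorem emptyCount_le_update_of {w : Fin n → Option (Fin n)} {a : Fin n} {m : Option (Fin n)}
    (h : w a ≠ none ∨ m = none) : emptyCount w ≤ emptyCount (Function.update w a m) := by
  unfold emptyCount
  refine Finset.card_le_card fun i hi => ?_
  simp only [Finset.mem_filter, Finset.mem_univ, true_and] at hi ⊢
  by_cases hia : i = a
  · subst hia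
    rcases h with h | h
    · exact absurd hi h
    · simp [h]
  · simpa [hia] using hi

variable (n) in
/-- The representation on functions of words whose letters are `1, …, n`. -/
def letterData (k : ℂ) : FusedData n k (Module.End ℂ ((Fin n → Option (Fin n)) → ℂ)) :=
  repData (letterWeight n k) (sum_letterWeight n k)

variable {k : ℂ}

theorem letterData_T_apply (a : Fin n) (f : (Fin n → Option (Fin n)) → ℂ)
    (w : Fin n → Option (Fin n)) : (letterData n k).T a f w
      = wordSum (letterWeight n k) w fun m => f (Function.update w a m) := rfl

theorem letterData_perm_apply (σ : Equiv.Perm (Fin n)) (f : (Fin n → Option (Fin n)) → ℂ)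
    (w : Fin n → Option (Fin n)) : (letterData n k).ρ σ f w = f (w ∘ σ) := rfl

/-- The indicator sees only a word without empty places, and each shifted generator fills at most
one; fewer generators than empty places give zero. -/
theorem prod_apply_of_lt (l : List (Fin n)) {w : Fin n → Option (Fin n)}
    (hw : l.length < emptyCount w) :
    (l.map (letterData n k).T).prod (stdIndicator n) w = 0 := by
  induction l generalizing w with
  | nil =>
    have : w ≠ stdWord [] := by
      rintro rfl
      rw [emptyCount_stdWord List.nodup_nil] at hw
      exact lt_irrefl _ hw
    simp [stdIndicator, this]
  | cons a l ih =>
    rw [List.map_cons, List.prod_cons, Module.End.mul_apply, letterData_T_apply]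
    have h : ∀ m, (l.map (letterData n k).T).prod (stdIndicator n) (Function.update w a m) = 0 := by
      intro m
      have := emptyCount_le_update w a m
      simp only [List.length_cons] at hw
      exact ih (by omega)
    simp [wordSum, h]

theorem mem_filt_apply {d : ℕ} {x : Module.End ℂ ((Fin n → Option (Fin n)) → ℂ)}
    (hx : x ∈ (letterData n k).filt d) {w : Fin n → Option (Fin n)} (hw : d ≤ emptyCount w) :
    x (stdIndicator n) w = 0 := by
  induction hx using Submodule.span_induction with
  | mem x hx =>
    obtain ⟨σ, l, hl, rfl⟩ := hx
    rw [FusedData.mono, Module.End.mul_apply, letterData_perm_apply]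
    exact prod_apply_of_lt l (by rw [emptyCount_comp]; omega)
  | zero => rfl
  | add x y _ _ hx hy => rw [LinearMap.add_apply, Pi.add_apply, hx, hy, add_zero]
  | smul c x _ hx => rw [LinearMap.smul_apply, Pi.smul_apply, hx, smul_zero]

theorem update_eq_stdWord_iff {w : Fin n → Option (Fin n)} {a : Fin n} {l : List (Fin n)}
    (ha : a ∉ l) (hw : w a = none) (m : Option (Fin n)) :
    Function.update w a m = stdWord l ↔ m = some a ∧ w = stdWord (a :: l) := by
  constructor
  · intro h
    refine ⟨by simpa [stdWord, ha] using congrFun h a, funext fun i => ?_⟩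
    have hi := congrFun h i
    by_cases hia : i = a
    · simp [hia, hw, stdWord]
    · simpa [hia, stdWord] using hi
  · rintro ⟨rfl, rfl⟩
    funext i
    by_cases hia : i = a
    · subst hia; simp [stdWord, ha]
    · simp [hia, stdWord]

/-- With exactly as many generators as empty places, none may be wasted: each T_a must fill an empty
place a, and only the letter a leads to the word 1 2 … n. -/
theorem prod_apply {l : List (Fin n)} (hl : l.Nodup) {w : Fin n → Option (Fin n)}
    (hw : emptyCount w = l.length) :
    (l.map (letterData n k).T).prod (stdIndicator n) w = if w = stdWord l then 1 else 0 := by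
  induction l generalizing w with
  | nil => rfl
  | cons a l ih =>
    rw [List.nodup_cons] at hl
    rw [List.map_cons, List.prod_cons, Module.End.mul_apply, letterData_T_apply]
    have h : ∀ m, (l.map (letterData n k).T).prod (stdIndicator n) (Function.update w a m)
        = if m = some a then (if w = stdWord (a :: l) then 1 else 0) else 0 := by
      intro m
      by_cases hm : w a ≠ none ∨ m = none
      · have h1 := emptyCount_le_update_of hm
        rw [prod_apply_of_lt l (by rw [hw, List.length_cons] at h1; omega)]
        rcases hm with hm | hm
        · have : w ≠ stdWord (a :: l) := by
            rintro rfl; simp [stdWord] at hm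
          simp [this]
        · simp [hm]
      · push Not at hm
        have h1 := emptyCount_le_update w a m
        rw [hw, List.length_cons] at h1
        by_cases h2 : emptyCount (Function.update w a m) = l.length
        · rw [ih hl.2 h2]
          simp only [update_eq_stdWord_iff hl.1 hm.1, ite_and]
        · rw [prod_apply_of_lt l (by omega)]
          by_cases h3 : m = some a ∧ w = stdWord (a :: l)
          · rw [← update_eq_stdWord_iff hl.1 hm.1] at h3
            rw [h3, emptyCount_stdWord hl.2] at h2
            exact absurd rfl h2
          · rw [← ite_and, if_neg h3]
    simp only [h]
    by_cases h4 : w = stdWord (a :: l)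
    · have h5 : ∀ j, w j ≠ some a := by
        intro j hj
        rw [h4, stdWord] at hj
        split_ifs at hj with h6
        · rw [Option.some.inj hj] at h6
          simp at h6
      simp [wordSum, h4 ▸ h5, letterWeight, h4]
    · simp [wordSum, h4]

/-- The distinct letters of the word force σ⁻¹ σ' to fix every place outside `l'`, and equality of
lengths forces the two sets to agree. Monotonicity then settles the places in the set. -/
theorem stdWord_comp_eq {σ σ' : Equiv.Perm (Fin n)} {l l' : List (Fin n)} (hl : l.Nodup)
    (hlen : l.length = l'.length)
    (hσ : ∀ i ∈ l, ∀ j ∈ l, i < j → σ j < σ i) (hσ' : ∀ i ∈ l', ∀ j ∈ l', i < j → σ' j < σ' i)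
    (h : stdWord l ∘ ⇑σ⁻¹ ∘ σ' = stdWord l') : σ = σ' ∧ ∀ i, i ∈ l ↔ i ∈ l' := by
  have h1 : ∀ i ∈ l', σ⁻¹ (σ' i) ∈ l := by
    intro i hi
    have := congrFun h i
    simp only [Function.comp_apply, stdWord, hi, if_true] at this
    by_contra hcon
    rw [if_neg hcon] at this
    exact Option.some_ne_none _ this
  have h2 : ∀ i ∉ l', σ⁻¹ (σ' i) ∉ l ∧ σ⁻¹ (σ' i) = i := by
    intro i hi
    have := congrFun h i
    simp only [Function.comp_apply, stdWord, hi, if_false] at this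
    split_ifs at this with h3
    exact ⟨h3, Option.some.inj this⟩
  have hsub : l ⊆ l' := by
    intro i hi
    by_contra hcon
    obtain ⟨h3, h4⟩ := h2 i hcon
    rw [h4] at h3
    exact h3 hi
  have hp : l.Perm l' := (List.subperm_of_subset hl hsub).perm_of_length_le hlen.ge
  have hmem : ∀ i, i ∈ l ↔ i ∈ l' := fun i => hp.mem_iff
  refine ⟨perm_eq_of_antitone (l := l') ?_ hσ' (fun i hi => (hmem _).mp (h1 i hi))
    (fun i hi => (h2 i hi).2), hmem⟩
  intro i hi j hj
  exact hσ i ((hmem i).mpr hi) j ((hmem j).mpr hj)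

theorem linearIndependent_of_hasLeading
    {v : {ω : SignedPerm n // Avoids ω} → Module.End ℂ ((Fin n → Option (Fin n)) → ℂ)}
    (hv : ∀ ω, (letterData n k).HasLeading ω.1 (v ω) (negCount ω.1)) :
    LinearIndependent ℂ v := by
  classical
  rw [Fintype.linearIndependent_iff]
  intro c hc
  by_contra hcon
  push Not at hcon
  obtain ⟨ω₁, hω₁⟩ := hcon
  -- In a linear relation take ω of maximal degree, with leading term σ T_l, and evaluate at
  -- `stdWord l ∘ σ⁻¹`: terms of lower degree vanish there, and among those of the same degree only
  -- ω survives.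
  obtain ⟨ω, hω, hmax⟩ := Finset.exists_max_image
    (Finset.univ.filter fun ω => c ω ≠ 0) (fun ω => negCount ω.1) ⟨ω₁, by simpa using hω₁⟩
  simp only [Finset.mem_filter, Finset.mem_univ, true_and] at hω hmax
  obtain ⟨σ, l, h1, h2, h3, h4⟩ := hv ω
  have hw : emptyCount (stdWord l ∘ ⇑σ⁻¹) = negCount ω.1 := by
    rw [emptyCount_comp, emptyCount_stdWord h2, h3]
  have hval : ∀ ω', c ω' • v ω' (stdIndicator n) (stdWord l ∘ ⇑σ⁻¹)
      = if ω' = ω then c ω else 0 := by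
    intro ω'
    by_cases hc' : c ω' = 0
    · have : ω' ≠ ω := by rintro rfl; exact hω hc'
      simp [hc', this]
    have hle := hmax ω' hc'
    rcases hle.lt_or_eq with hlt | heq
    · have : ω' ≠ ω := by rintro rfl; exact lt_irrefl _ hlt
      rw [mem_filt_apply (hv ω').mem_filt (by rw [hw]; omega)]
      simp [this]
    · obtain ⟨σ', l', h1', h2', h3', h4'⟩ := hv ω'
      have e := mem_filt_apply h4' (w := stdWord l ∘ ⇑σ⁻¹) (by rw [hw, heq])
      rw [LinearMap.sub_apply, Pi.sub_apply, sub_eq_zero] at e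
      rw [e, FusedData.mono, Module.End.mul_apply, letterData_perm_apply,
        prod_apply h2' (by rw [emptyCount_comp, hw, h3', heq])]
      by_cases hωω : ω' = ω
      · subst hωω
        obtain ⟨rfl, hmem⟩ := h1.unique h1'
        have : (stdWord l ∘ ⇑σ⁻¹) ∘ σ = stdWord l' := by
          funext i
          have : σ⁻¹ (σ i) = i := σ.symm_apply_apply i
          simp only [Function.comp_apply, this, stdWord, hmem]
        rw [if_pos this, if_pos rfl, smul_eq_mul, mul_one]
      · rw [if_neg hωω, if_neg, smul_zero]
        intro hst
        obtain ⟨rfl, hmem⟩ := stdWord_comp_eq h2 (by rw [h3, h3', heq]) (h1.antitone ω.2)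
          (h1'.antitone ω'.2) hst
        exact hωω (Subtype.ext (h1'.ext h1 fun i => (hmem i).symm))
  have := congrFun (LinearMap.congr_fun hc (stdIndicator n)) (stdWord l ∘ ⇑σ⁻¹)
  simp only [LinearMap.sum_apply, LinearMap.smul_apply, Finset.sum_apply, Pi.smul_apply, hval,
    Finset.sum_ite_eq', Finset.mem_univ, if_true] at this
  exact hω this

end Independent

/-! ### The presentation of the quotient algebra -/

theorem commute_of_conj {n : ℕ} {k : ℂ} {B : Type*} [Ring B] [Algebra ℂ B] (D : FusedData n k B)
    {σ : Equiv.Perm (Fin n)} {a : Fin n} (h : σ a = a) : Commute (D.ρ σ) (D.T a) := by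
  have := D.conj σ a
  rwa [h] at this

section DataRel

variable {n : ℕ} {κ₁ κ₂ : ℂ} {B : Type*} [Ring B] [Algebra ℂ B]
  (D : FusedData n (κ₂ - κ₁ - 1) B)

/-- The generators `x_{r+1}`. -/
def FusedData.genX (r : Fin n) : B :=
  D.T r + algebraMap ℂ B (1 + κ₁) + jucysMurphy D.ρ r

theorem FusedData.genX_zero (hn : 0 < n) :
    D.genX ⟨0, hn⟩ = D.T ⟨0, hn⟩ + (1 + κ₁) • 1 := by
  have : jucysMurphy D.ρ ⟨0, hn⟩ = 0 := Finset.sum_eq_zero fun i hi => by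
    simp [Fin.lt_def] at hi
  rw [genX, this, add_zero, Algebra.algebraMap_eq_smul_one]

theorem FusedData.commute_perm_genX {σ : Equiv.Perm (Fin n)} {r : Fin n}
    (hr : σ r = r) (hσ : ∀ i, i < r ↔ σ i < r) : Commute (D.ρ σ) (D.genX r) :=
  ((commute_of_conj D hr).add_right (Algebra.commutes _ _).symm).add_right
    (commute_jucysMurphy D.ρ hr hσ)

/-- By `D.comm`, T_r commutes with T_t + (r t), and the other transpositions (i t) fix r. The
transpositions (i r) in the Jucys–Murphy element of r fix t and preserve the indices below t, so
they commute with all of `D.genX t`. -/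
theorem FusedData.commute_genX {r t : Fin n} (h : r < t) : Commute (D.genX r) (D.genX t) := by
  refine Commute.add_left (Commute.add_left ?_ (Algebra.commutes _ _)) ?_
  · have hr : r ∈ Finset.univ.filter fun i => i < t := by simpa using h
    have e : D.genX t = (D.T t + D.ρ (Equiv.swap r t)) + algebraMap ℂ B (1 + κ₁)
        + ∑ i ∈ (Finset.univ.filter fun i => i < t).erase r, D.ρ (Equiv.swap i t) := by
      rw [FusedData.genX, jucysMurphy, ← Finset.add_sum_erase _ _ hr]
      abel
    rw [e]
    refine Commute.add_right (Commute.add_right ?_ (Algebra.commutes _ _).symm) ?_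
    · have h1 := D.comm r t h.ne
      have h2 := D.conj (Equiv.swap r t) r
      have h3 := D.conj (Equiv.swap r t) t
      rw [Equiv.swap_apply_left] at h2
      rw [Equiv.swap_apply_right] at h3
      unfold Commute SemiconjBy
      rw [mul_add, add_mul, ← h3, h2, sub_eq_sub_iff_add_eq_add] at *
      rw [add_comm (D.T t * D.T r), ← h1, add_comm]
    · refine Commute.sum_right _ _ _ fun i hi => (commute_of_conj D ?_).symm
      simp only [Finset.mem_erase, Finset.mem_filter, Finset.mem_univ, true_and] at hi
      exact Equiv.swap_apply_of_ne_of_ne hi.1.symm h.ne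
  · refine Commute.sum_left _ _ _ fun i hi => D.commute_perm_genX ?_ fun j => ?_
    · simp only [Finset.mem_filter, Finset.mem_univ, true_and] at hi
      exact Equiv.swap_apply_of_ne_of_ne (hi.trans h).ne' h.ne'
    · simp only [Finset.mem_filter, Finset.mem_univ, true_and] at hi
      simp only [Equiv.swap_apply_def, Fin.lt_def, Fin.ext_iff] at *
      grind

/-- The converse of `FusedRel.data`, needed to make the representation on words factor through the
quotient algebra. -/
theorem FusedData.rel :
    FusedRel n κ₁ κ₂ D.genX (fun i => D.ρ (adjSwap n i)) where
  adj :=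
    ⟨fun i h1 h2 => by rw [← map_mul, (adjSwap_rel n).sq i h1 h2, map_one],
      fun i j h1 h2 h3 => by rw [← map_mul, (adjSwap_rel n).comm i j h1 h2 h3, map_mul],
      fun i h1 h2 => by simp only [← map_mul, (adjSwap_rel n).braid i h1 h2]⟩
  quad hn := by
    simp only [Algebra.algebraMap_eq_smul_one]
    exact (shift_quad_iff (D.genX_zero hn)).mpr (D.quad _)
  x_s r i hi hin h h' := by
    refine (D.commute_perm_genX ?_ fun j => ?_).symm
    · rw [adjSwap_of_lt hi hin]
      exact Equiv.swap_apply_of_ne_of_ne (fun e => h (by simp [e]; omega))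
        (fun e => h' (by simp [e]))
    · rw [adjSwap_of_lt hi hin]
      simp only [Equiv.swap_apply_def, Fin.lt_def, Fin.ext_iff]
      grind
  x_comm r t := by
    rcases lt_trichotomy r t with h | h | h
    · exact D.commute_genX h
    · rw [h]
    · exact (D.commute_genX h).symm
  x_succ i hi hin := by
    have hj := jucysMurphy_succ D.ρ (r := (⟨i - 1, by omega⟩ : Fin n))
      (r' := ⟨i, hin⟩) (by simp; omega)
    rw [← adjSwap_of_lt hi hin] at hj
    have hs : D.ρ (adjSwap n i) * D.ρ (adjSwap n i) = 1 := by
      rw [← map_mul, adjSwap_mul_self, map_one]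
    have hc : D.ρ (adjSwap n i) * algebraMap ℂ B (1 + κ₁) * D.ρ (adjSwap n i)
        = algebraMap ℂ B (1 + κ₁) := by
      rw [← Algebra.commutes, mul_assoc, hs, mul_one]
    have hT : D.ρ (adjSwap n i) * D.T ⟨i - 1, by omega⟩ * D.ρ (adjSwap n i) = D.T ⟨i, hin⟩ := by
      rw [D.conj, mul_assoc, hs, mul_one, adjSwap_of_lt hi hin, Equiv.swap_apply_left]
    rw [genX, genX, hj, mul_add, mul_add, add_mul, add_mul, hT, hc]
    abel
  extra h := by
    have hs : D.ρ (adjSwap n 1) * D.ρ (adjSwap n 1) = 1 := by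
      rw [← map_mul, adjSwap_mul_self, map_one]
    refine (shift_extra_iff hs (D.genX_zero (by omega))).mpr ?_
    have hT : D.ρ (adjSwap n 1) * D.T ⟨0, by omega⟩ * D.ρ (adjSwap n 1) = D.T ⟨1, h⟩ := by
      rw [D.conj, mul_assoc, hs, mul_one, ← swap_zero_one h, Equiv.swap_apply_left]
    rw [hT, ← swap_zero_one h]
    exact D.fuse _ _ (by simp)

end DataRel

section Quot

variable (n : ℕ) (κ₁ κ₂ : ℂ)

/-- The image of `x_{r+1}` in `A_n^κ`. -/
noncomputable def quotX (r : Fin n) : QuotAlg n κ₁ κ₂ :=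
  toQuot n κ₁ κ₂ (heckeX n κ₁ κ₂ (r + 1) ⟨by omega, by omega⟩)

/-- The image of `s_i` in `A_n^κ`, for `1 ≤ i < n`. -/
noncomputable def quotS (i : ℕ) : QuotAlg n κ₁ κ₂ :=
  if h : 1 ≤ i ∧ i < n then toQuot n κ₁ κ₂ (heckeS n κ₁ κ₂ i h) else 1

variable {n}

theorem quotS_of_lt {i : ℕ} (h : 1 ≤ i ∧ i < n) :
    quotS n κ₁ κ₂ i = toQuot n κ₁ κ₂ (heckeS n κ₁ κ₂ i h) := dif_pos h

theorem hecke_rel {a b : FreeAlgebra ℂ (Gen n)} (h : HeckeRel n κ₁ κ₂ a b) :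
    toQuot n κ₁ κ₂ (RingQuot.mkAlgHom ℂ _ a) = toQuot n κ₁ κ₂ (RingQuot.mkAlgHom ℂ _ b) :=
  congrArg _ (RingQuot.mkAlgHom_rel ℂ h)

theorem quotRel : FusedRel n κ₁ κ₂ (quotX n κ₁ κ₂) (quotS n κ₁ κ₂) where
  adj :=
    { sq := fun i hi hin => by
        have := hecke_rel κ₁ κ₂ (HeckeRel.s_sq i ⟨hi, hin⟩)
        rw [map_pow, map_pow, map_one, map_one, pow_two] at this
        rw [quotS_of_lt _ _ ⟨hi, hin⟩]
        exact this
      comm := fun i j hi hij hj => by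
        have := hecke_rel κ₁ κ₂
          (HeckeRel.s_comm i j ⟨hi, by omega⟩ ⟨by omega, hj⟩ (Or.inl hij))
        simp only [map_mul] at this
        rw [quotS_of_lt _ _ ⟨hi, by omega⟩, quotS_of_lt _ _ ⟨by omega, hj⟩]
        exact this
      braid := fun i hi hin => by
        have := hecke_rel κ₁ κ₂ (HeckeRel.braid i ⟨hi, by omega⟩ ⟨by omega, hin⟩)
        simp only [map_mul] at this
        rw [quotS_of_lt _ _ ⟨hi, by omega⟩, quotS_of_lt _ _ ⟨by omega, hin⟩]
        exact this }
  quad hn := by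
    have := hecke_rel κ₁ κ₂ (HeckeRel.quadratic (n := n) ⟨le_rfl, hn⟩)
    simp only [map_mul, map_sub, map_zero, AlgHom.commutes] at this
    exact this
  x_s r i hi hin h h' := by
    have := hecke_rel κ₁ κ₂
      (HeckeRel.x_s_comm (n := n) ((r : ℕ) + 1) i ⟨by omega, by omega⟩ ⟨hi, hin⟩ h (by omega))
    simp only [map_mul] at this
    rw [quotS_of_lt _ _ ⟨hi, hin⟩]
    exact this
  x_comm r t := by
    have := hecke_rel κ₁ κ₂
      (HeckeRel.x_comm (n := n) ((r : ℕ) + 1) ((t : ℕ) + 1) ⟨by omega, by omega⟩ ⟨by omega, by omega⟩)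
    simp only [map_mul] at this
    exact this
  x_succ i hi hin := by
    obtain ⟨p, rfl⟩ : ∃ p, i = p + 1 := ⟨i - 1, by omega⟩
    have := hecke_rel κ₁ κ₂ (HeckeRel.x_succ (n := n) (p + 1) ⟨hi, by omega⟩ ⟨by omega, by omega⟩
      ⟨hi, hin⟩)
    simp only [map_mul, map_add] at this
    rw [quotS_of_lt _ _ ⟨hi, hin⟩]
    exact this
  extra h := by
    have := RingQuot.mkAlgHom_rel ℂ (QuotRel.rel (n := n) (κ₁ := κ₁) (κ₂ := κ₂)
      (heckeX n κ₁ κ₂ 1 ⟨le_rfl, by omega⟩) (heckeS n κ₁ κ₂ 1 ⟨le_rfl, h⟩) ⟨le_rfl, by omega⟩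
      ⟨le_rfl, h⟩ rfl rfl)
    simp only [map_mul, map_add, map_sub, map_pow, map_one, map_smul] at this
    rw [quotS_of_lt _ _ ⟨le_rfl, h⟩]
    exact this

variable {κ₁ κ₂} in
theorem FusedRel.exists_lift {B : Type*} [Ring B] [Algebra ℂ B] {X : Fin n → B} {S : ℕ → B}
    (R : FusedRel n κ₁ κ₂ X S) :
    ∃ F : QuotAlg n κ₁ κ₂ →ₐ[ℂ] B, (∀ r, F (quotX n κ₁ κ₂ r) = X r) ∧
      ∀ i, 1 ≤ i → i < n → F (quotS n κ₁ κ₂ i) = S i := by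
  let f₀ : FreeAlgebra ℂ (Gen n) →ₐ[ℂ] B := FreeAlgebra.lift ℂ fun
    | Gen.x r hr => X ⟨r - 1, by omega⟩
    | Gen.s i _ => S i
  have fx : ∀ r hr, f₀ (freeX r hr) = X ⟨r - 1, by omega⟩ := fun r hr =>
    FreeAlgebra.lift_ι_apply _ _
  have fs : ∀ i hi, f₀ (freeS i hi) = S i := fun i hi => FreeAlgebra.lift_ι_apply _ _
  have h₀ : ∀ ⦃x y⦄, HeckeRel n κ₁ κ₂ x y → f₀ x = f₀ y := by
    intro x y h
    induction h with
    | quadratic h =>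
      simp only [map_mul, map_sub, map_zero, AlgHom.commutes, fx]
      exact R.quad h.2
    | x_s_comm r l hr hl h h' =>
      simp only [map_mul, fx, fs]
      exact R.x_s _ l hl.1 hl.2 (by simp; omega) (by simp; omega)
    | x_comm r t hr ht =>
      simp only [map_mul, fx]
      exact R.x_comm _ _
    | x_succ r hr hr' hs =>
      simp only [map_mul, map_add, fx, fs]
      obtain ⟨p, rfl⟩ : ∃ p, r = p + 1 := ⟨r - 1, by omega⟩
      exact R.x_succ (p + 1) hs.1 hs.2
    | s_sq i hi =>
      simp only [pow_two, map_mul, map_one, fs]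
      exact R.adj.sq i hi.1 hi.2
    | s_comm i j hi hj h =>
      simp only [map_mul, fs]
      rcases h with h | h
      · exact R.adj.comm i j hi.1 h hj.2
      · exact (R.adj.comm j i hj.1 h hi.2).symm
    | braid i hi hi' =>
      simp only [map_mul, fs]
      exact R.adj.braid i hi.1 hi'.2
  let f₁ : Hecke n κ₁ κ₂ →ₐ[ℂ] B := RingQuot.liftAlgHom ℂ ⟨f₀, h₀⟩
  have f₁x : ∀ r hr, f₁ (heckeX n κ₁ κ₂ r hr) = X ⟨r - 1, by omega⟩ := fun r hr =>
    (RingQuot.liftAlgHom_mkAlgHom_apply ℂ f₀ h₀ _).trans (fx r hr)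
  have f₁s : ∀ i hi, f₁ (heckeS n κ₁ κ₂ i hi) = S i := fun i hi =>
    (RingQuot.liftAlgHom_mkAlgHom_apply ℂ f₀ h₀ _).trans (fs i hi)
  have h₁ : ∀ ⦃x y⦄, QuotRel n κ₁ κ₂ x y → f₁ x = f₁ y := by
    intro x y h
    induction h with
    | rel x s hx hs ex es =>
      subst ex es
      simp only [map_mul, map_add, map_sub, map_pow, map_one, map_smul, f₁x, f₁s]
      exact R.extra hs.2
  refine ⟨RingQuot.liftAlgHom ℂ ⟨f₁, h₁⟩, fun r => ?_, fun i hi hin => ?_⟩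
  · exact (RingQuot.liftAlgHom_mkAlgHom_apply ℂ f₁ h₁ _).trans (f₁x _ _)
  · rw [quotS_of_lt _ _ ⟨hi, hin⟩]
    exact (RingQuot.liftAlgHom_mkAlgHom_apply ℂ f₁ h₁ _).trans (f₁s _ _)

/-- Used to see that the filtration exhausts the algebra. -/
theorem quot_submodule_eq_top (U : Submodule ℂ (QuotAlg n κ₁ κ₂)) (h1 : 1 ∈ U)
    (hX : ∀ r, ∀ u ∈ U, quotX n κ₁ κ₂ r * u ∈ U)
    (hS : ∀ i, 1 ≤ i → i < n → ∀ u ∈ U, quotS n κ₁ κ₂ i * u ∈ U) : U = ⊤ := by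
  have key : ∀ a : FreeAlgebra ℂ (Gen n), ∀ u ∈ U,
      toQuot n κ₁ κ₂ (RingQuot.mkAlgHom ℂ (HeckeRel n κ₁ κ₂) a) * u ∈ U := by
    intro a
    induction a using FreeAlgebra.induction with
    | grade0 r =>
      intro u hu
      rw [AlgHom.commutes, AlgHom.commutes, ← Algebra.smul_def]
      exact U.smul_mem _ hu
    | grade1 x =>
      intro u hu
      cases x with
      | x r hr =>
        have := hX ⟨r - 1, by omega⟩ u hu
        obtain ⟨p, rfl⟩ : ∃ p, r = p + 1 := ⟨r - 1, by omega⟩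
        exact this
      | s i hi =>
        have := hS i hi.1 hi.2 u hu
        rw [quotS_of_lt _ _ hi] at this
        exact this
    | mul a b ha hb =>
      intro u hu
      rw [map_mul, map_mul, mul_assoc]
      exact ha _ (hb u hu)
    | add a b ha hb =>
      intro u hu
      rw [map_add, map_add, add_mul]
      exact U.add_mem (ha u hu) (hb u hu)
  rw [eq_top_iff]
  intro x _
  obtain ⟨y, rfl⟩ := RingQuot.mkAlgHom_surjective ℂ (QuotRel n κ₁ κ₂) x
  obtain ⟨a, rfl⟩ := RingQuot.mkAlgHom_surjective ℂ (HeckeRel n κ₁ κ₂) y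
  have := key a 1 h1
  rwa [mul_one] at this

end Quot

/-! ### The basis -/

section Words

variable {M N F : Type*} [Monoid M] [Monoid N] [FunLike F M N] [MonoidHomClass F M N] {n : ℕ}
  (f : F) (g : Fin n → M)

theorem map_desc (m : Fin n) (a : ℕ) : f (desc g m a) = desc (fun i => f (g i)) m a := by
  simp only [desc, map_list_prod, List.map_ofFn]
  rfl

theorem map_asc (m : Fin n) (j : Fin (m + 1)) : f (asc g m j) = asc (fun i => f (g i)) m j := by
  simp only [asc, map_list_prod, List.map_ofFn]
  rfl

theorem map_normalProd (c : NormalForm n) :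
    f (normalProd g c) = normalProd (fun i => f (g i)) c := by
  have : ∀ k hk, f (partialProd g c k hk) = partialProd (fun i => f (g i)) c k hk := by
    intro k hk
    induction k with
    | zero => exact map_one f
    | succ k ih =>
      rw [partialProd, partialProd, map_mul, ih, factor, factor]
      split
      · rw [map_mul, map_desc, map_asc]
      · rw [map_desc]
  exact this n le_rfl

variable (n) in
/-- The normal form of the longest word `x_1 · s_1 x_1 · s_2 s_1 x_1 ⋯`. -/
def fullForm : NormalForm n := fun _ => (true, 0)

theorem factor_fullForm (m : Fin n) : factor g m (fullForm n m) = desc g m 0 := by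
  simp [factor, fullForm, asc]

theorem partialProd_fullForm (k : ℕ) (hk : k ≤ n) :
    partialProd g (fullForm n) k hk
      = (List.ofFn fun m : Fin k => desc g ⟨m, by omega⟩ 0).prod := by
  induction k with
  | zero => rfl
  | succ k ih =>
    rw [partialProd, ih, factor_fullForm, List.ofFn_succ', List.concat_eq_append, List.prod_append,
      List.prod_singleton]
    rfl

end Words

/-! ### The signed permutation n̄ ⋯ 2̄ 1̄ and the count n! -/

section Full

variable {n : ℕ}

theorem desc_shift (m : Fin n) (l : ℕ) (hl : l ≤ m) (j : SignedSet n) (hj : 0 < j.1) :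
    ((m : ℤ) + 1 < j.1 + l → j.1 ≤ (m : ℤ) + 1 →
      (((List.ofFn fun t : Fin l => tau (⟨m - t, by omega⟩ : Fin n)).prod).1 j).1 = j.1 - 1) ∧
    (j.1 + l ≤ (m : ℤ) →
      (((List.ofFn fun t : Fin l => tau (⟨m - t, by omega⟩ : Fin n)).prod).1 j).1 = j.1) := by
  induction l generalizing j with
  | zero =>
    refine ⟨fun h h' => ?_, fun _ => by simp⟩
    simp only [Nat.cast_zero, add_zero] at h
    omega
  | succ l ih =>
    rw [List.ofFn_succ', List.concat_eq_append, List.prod_append, List.prod_singleton]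
    have h1 : (((m : ℕ) - l : ℕ) : ℤ) = (m : ℤ) - l := by omega
    have h3 : (m : ℕ) - l ≠ 0 := by omega
    have hv : ((tau (⟨m - l, by omega⟩ : Fin n)).1 j).1
        = if j.1 = (m : ℤ) - l then (m : ℤ) - l + 1
          else if j.1 = (m : ℤ) - l + 1 then (m : ℤ) - l else j.1 := by
      rw [tau_val]
      simp only [tauFun, h1, h3, if_false]
      have e1 : j.1 ≠ -((m : ℤ) - l) := by omega
      have e2 : j.1 ≠ -((m : ℤ) - l + 1) := by omega
      simp only [e1, e2, if_false]
    obtain ⟨i1, i2⟩ := ih (by omega) ((tau (⟨m - l, by omega⟩ : Fin n)).1 j) (by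
      rw [hv]; split_ifs <;> omega)
    simp only [Nat.cast_add, Nat.cast_one]
    constructor
    · intro h h'
      by_cases hj' : j.1 = (m : ℤ) - l + 1
      · rw [if_neg (by omega), if_pos hj'] at hv
        exact (i2 (by omega)).trans (hv.trans (by omega))
      · rw [if_neg (by omega), if_neg hj'] at hv
        exact (i1 (by omega) (by omega)).trans (by rw [hv])
    · intro h
      rw [if_neg (by omega), if_neg (by omega)] at hv
      exact (i2 (by omega)).trans hv

theorem desc_zero_pos_zero (m : Fin n) :
    (desc tau m 0).1 (pos ⟨0, m.pos⟩) = -pos m := by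
  have h : pos ⟨0, m.pos⟩ = -(-pos ⟨0, m.pos⟩ : SignedSet n) := Subtype.ext (neg_neg _).symm
  rw [h, (desc tau m 0).2]
  refine congrArg _ (Subtype.ext ?_)
  rw [desc_zero_apply m _ (by simp [pos])]
  rfl

theorem desc_zero_pos_succ (m : Fin n) (i : ℕ) (hi : i + 1 ≤ m) :
    (desc tau m 0).1 (pos ⟨i + 1, by omega⟩) = pos ⟨i, by omega⟩ := by
  rw [desc_zero_eq]
  change (desc tau m 1).1 ((tau ⟨0, _⟩).1 _) = _
  rw [tau_zero_pos, if_neg (by simp)]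
  apply Subtype.ext
  refine ((desc_shift m m le_rfl (pos ⟨i + 1, by omega⟩) (by simp only [pos]; omega)).1 ?_ ?_).trans
    ?_
  all_goals simp only [pos]; omega

/-- The factor τ_k ⋯ τ_1 τ_0 sends 1 to -(k + 1) and lowers 2, …, k + 1 by one; the earlier factors
fix ±(k + 1). -/
theorem partialProd_fullForm_apply (k : ℕ) (hk : k ≤ n) (i : ℕ) (hi : i < k) :
    ((partialProd tau (fullForm n) k hk).1 (pos ⟨i, by omega⟩)).1 = -((k : ℤ) - i) := by
  induction k generalizing i with
  | zero => omega
  | succ k ih =>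
    change ((partialProd tau (fullForm n) k _).1 ((factor tau ⟨k, hk⟩ _).1 _)).1 = _
    rw [factor_fullForm]
    cases i with
    | zero =>
      rw [desc_zero_pos_zero ⟨k, hk⟩, (partialProd tau (fullForm n) k _).2,
        partialProd_mem (fullForm n) k (by omega) _ (by simp only [pos]; grind)]
      simp [pos]
    | succ i =>
      rw [desc_zero_pos_succ ⟨k, hk⟩ i (by simp only; omega), ih (by omega) i (by omega)]
      push_cast
      ring

variable (n) in
/-- The signed permutation `n̄ ⋯ 2̄ 1̄`. -/
noncomputable def fullPerm : SignedPerm n := normalForm.symm (fullForm n)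

theorem fullPerm_apply (i : Fin n) : ((fullPerm n).1 (pos i)).1 = -((n : ℤ) - i) :=
  partialProd_fullForm_apply n le_rfl i i.2

theorem avoids_fullPerm : Avoids (fullPerm n) := by
  intro i j hij _ _
  rw [fullPerm_apply, fullPerm_apply, abs_neg, abs_neg]
  rw [Fin.lt_def] at hij
  grind

theorem negCount_eq_iff (ω : SignedPerm n) :
    negCount ω = n ↔ ∀ i, (ω.1 (pos i)).1 < 0 := by
  unfold negCount
  constructor
  · intro h i
    have : (Finset.univ.filter fun i => (ω.1 (pos i)).1 < 0) = Finset.univ :=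
      Finset.eq_univ_of_card _ (by simpa using h)
    have hi := Finset.mem_univ i
    rw [← this] at hi
    simpa using hi
  · intro h
    simp [h]

theorem negCount_fullPerm : negCount (fullPerm n) = n := by
  rw [negCount_eq_iff]
  intro i
  rw [fullPerm_apply]
  have := i.2
  omega

/-- The sum factors over `m`, and the `m`-th set has m + 1 labels `true`. -/
theorem sum_all_true : (∑ c : NormalForm n, if ∀ m, (c m).1 = true then (1 : ℂ) else 0) = n ! := by
  have h := Finset.prod_univ_sum (fun m : Fin n => (Finset.univ : Finset (Bool × Fin (m + 1))))
    (fun m d => if d.1 = true then (1 : ℂ) else 0)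
  rw [Fintype.piFinset_univ] at h
  have h1 : ∀ m : Fin n, (∑ d : Bool × Fin (m + 1), if d.1 = true then (1 : ℂ) else 0)
      = ((m : ℕ) + 1 : ℕ) := by
    intro m
    rw [Fintype.sum_prod_type]
    simp
  simp only [h1] at h
  rw [Fin.prod_univ_eq_prod_range (fun m => ((m + 1 : ℕ) : ℂ)), ← Nat.cast_prod,
    Finset.prod_range_add_one_eq_factorial] at h
  rw [h]
  refine Finset.sum_congr rfl fun c _ => ?_
  by_cases hc : ∀ m, (c m).1 = true
  · simp [hc]
  · rw [if_neg hc]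
    push Not at hc
    obtain ⟨m, hm⟩ := hc
    exact (Finset.prod_eq_zero (Finset.mem_univ m) (if_neg hm)).symm

end Full

/-! ### Spanning, independence and the coefficient of Δ -/

section Basis

variable {n : ℕ} {κ₁ κ₂ : ℂ} {A : Type*} [Ring A] [Algebra ℂ A] {X : Fin n → A} {S : ℕ → A}

theorem FusedRel.isLetter (R : FusedRel n κ₁ κ₂ X S) (hn : 0 < n) {g : Fin n → A}
    (h0 : g ⟨0, hn⟩ = X ⟨0, hn⟩) (hg : ∀ i : Fin n, (i : ℕ) ≠ 0 → g i = S i) :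
    (R.data hn).IsLetter g (1 + κ₁) where
  zero _ := by
    change _ = R.shift _ + _
    rw [h0, R.shift_zero hn, Algebra.algebraMap_eq_smul_one, sub_add_cancel]
  pos i hi := (hg i hi).trans (R.perm_adjSwap (by omega) i.2).symm

/-- Left multiplication by an x raises the degree by at most one, and by a permutation not at all.
-/
theorem FusedRel.iSup_filt (R : FusedRel n κ₁ κ₂ X S) (hn : 0 < n)
    (hgen : ∀ U : Submodule ℂ A, 1 ∈ U → (∀ r, ∀ u ∈ U, X r * u ∈ U) →
      (∀ i, 1 ≤ i → i < n → ∀ u ∈ U, S i * u ∈ U) → U = ⊤) :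
    ⨆ d, (R.data hn).filt d = ⊤ := by
  set D := R.data hn with hD
  have hmem : ∀ x, x ∈ ⨆ d, D.filt d ↔ ∃ d, x ∈ D.filt d := fun x =>
    Submodule.mem_iSup_of_directed _ (monotone_nat_of_le_succ fun d =>
      FusedData.filt_mono (Nat.le_succ d)).directed_le
  refine hgen _ ?_ ?_ ?_
  · rw [hmem]
    refine ⟨1, ?_⟩
    rw [← map_one D.ρ]
    exact FusedData.perm_mem_filt 1 one_pos
  · intro r u hu
    rw [hmem] at hu ⊢
    obtain ⟨d, hu⟩ := hu
    refine ⟨d + 1, ?_⟩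
    have up := FusedData.filt_mono (D := D) (Nat.le_succ d)
    have e : X r = D.T r + algebraMap ℂ A (1 + κ₁) + jucysMurphy D.ρ r := R.X_eq r
    rw [e, add_mul, add_mul]
    refine add_mem (add_mem (FusedData.T_mul_mem hu r) ?_) (up ?_)
    · rw [← Algebra.smul_def]
      exact Submodule.smul_mem _ _ (up hu)
    · rw [jucysMurphy, Finset.sum_mul]
      exact sum_mem fun i _ => FusedData.perm_mul_mem hu _
  · intro i hi hin u hu
    rw [hmem] at hu ⊢
    obtain ⟨d, hu⟩ := hu
    refine ⟨d, ?_⟩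
    rw [← R.perm_adjSwap hi hin]
    exact FusedData.perm_mul_mem (D := D) hu _

theorem linearIndependent_normalProd (hn : 0 < n)
    (hlift : ∃ F : A →ₐ[ℂ] Module.End ℂ ((Fin n → Option (Fin n)) → ℂ),
      (∀ r, F (X r) = (letterData n (κ₂ - κ₁ - 1)).genX r) ∧
      ∀ i, 1 ≤ i → i < n → F (S i) = (letterData n (κ₂ - κ₁ - 1)).ρ (adjSwap n i))
    {g : Fin n → A} (h0 : g ⟨0, hn⟩ = X ⟨0, hn⟩) (hg : ∀ i : Fin n, (i : ℕ) ≠ 0 → g i = S i) :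
    LinearIndependent ℂ fun ω : {ω : SignedPerm n // Avoids ω} =>
      normalProd g (normalForm ω.1) := by
  obtain ⟨F, hX, hS⟩ := hlift
  have hlet : (letterData n (κ₂ - κ₁ - 1)).IsLetter (fun i => F (g i)) (1 + κ₁) :=
    ⟨fun _ => by rw [h0, hX, FusedData.genX_zero],
      fun i hi => by rw [hg i hi, hS i (by omega) i.2]⟩
  refine LinearIndependent.of_comp F.toLinearMap ?_
  refine linearIndependent_of_hasLeading (k := κ₂ - κ₁ - 1) fun ω => ?_
  have h := FusedData.hasLeading_normalProd hlet ω.1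
  rw [← h.eq_negCount]
  have e : F (normalProd g (normalForm ω.1))
      = normalProd (fun i => F (g i)) (normalForm ω.1) :=
    map_normalProd F g _
  change (letterData n (κ₂ - κ₁ - 1)).HasLeading ω.1 (F (normalProd g (normalForm ω.1))) _
  rw [e]
  exact h

/-- Modulo lower terms, the normal forms of the signed permutations with only negative values are
all equal. -/
theorem FusedData.normalProd_sub_mem {k : ℂ} {D : FusedData n k A} {g : Fin n → A} {c : ℂ}
    (hg : D.IsLetter g c) {ω : SignedPerm n} (hω : negCount ω = n) :
    normalProd g (normalForm ω) - normalProd g (normalForm (fullPerm n)) ∈ D.filt n := by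
  obtain ⟨σ, l, h1, h2, h3, h4⟩ := hasLeading_normalProd hg ω
  rw [← negCount_eq_trueCount hg, hω] at h3 h4
  obtain ⟨ω', h5, h6, h7⟩ := exists_avoids_mono hg σ h2
  rw [h3] at h6 h7
  -- When all positions are negative, avoidance makes the underlying permutation decreasing on all
  -- of {1, …, n}, which leaves one possibility.
  have hω' : ω' = fullPerm n := by
    obtain ⟨σ₁, l₁, a1, a2, -, -⟩ := hasLeading_normalProd hg ω'
    obtain ⟨σ₂, l₂, b1, b2, -, -⟩ := hasLeading_normalProd hg (fullPerm n)
    have m1 : ∀ i, i ∈ l₁ := fun i => (a1.neg_iff i).mp ((negCount_eq_iff ω').mp h6 i)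
    have m2 : ∀ i, i ∈ l₂ := fun i =>
      (b1.neg_iff i).mp ((negCount_eq_iff _).mp negCount_fullPerm i)
    have b3 := b1.antitone avoids_fullPerm
    obtain rfl : σ₁ = σ₂ := perm_eq_of_antitone (a1.antitone h5)
      (fun i _ j _ => b3 i (m2 i) j (m2 j)) (fun i _ => m1 _) (fun i hi => absurd (m1 i) hi)
    exact a1.ext b1 fun i => by simp [m1, m2]
  rw [← hω']
  simpa using add_mem h4 h7

theorem FusedRel.exists_basis (R : FusedRel n κ₁ κ₂ X S) (hn : 0 < n)
    (hgen : ∀ U : Submodule ℂ A, 1 ∈ U → (∀ r, ∀ u ∈ U, X r * u ∈ U) →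
      (∀ i, 1 ≤ i → i < n → ∀ u ∈ U, S i * u ∈ U) → U = ⊤)
    (hlift : ∃ F : A →ₐ[ℂ] Module.End ℂ ((Fin n → Option (Fin n)) → ℂ),
      (∀ r, F (X r) = (letterData n (κ₂ - κ₁ - 1)).genX r) ∧
      ∀ i, 1 ≤ i → i < n → F (S i) = (letterData n (κ₂ - κ₁ - 1)).ρ (adjSwap n i))
    {g : Fin n → A} (h0 : g ⟨0, hn⟩ = X ⟨0, hn⟩) (hg : ∀ i : Fin n, (i : ℕ) ≠ 0 → g i = S i) :
    ∃ b : Module.Basis {ω : SignedPerm n // Avoids ω} ℂ A,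
      (∀ ω, b ω = normalProd g (normalForm ω.1)) ∧
      b.repr (∑ ω : SignedPerm n, (∏ i : Fin n, ((i : ℂ) - κ₂) ^ (1 - mult ω i)) •
        normalProd g (normalForm ω)) ⟨fullPerm n, avoids_fullPerm⟩ = (n ! : ℂ) := by
  have hlet := R.isLetter hn h0 hg
  set D := R.data hn
  have hspan : ⊤ ≤ Submodule.span ℂ (Set.range fun ω : {ω : SignedPerm n // Avoids ω} =>
      normalProd g (normalForm ω.1)) := by
    rw [← R.iSup_filt hn hgen]
    refine iSup_le fun d => (FusedData.filt_le_span hlet d).trans (Submodule.span_mono ?_)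
    rintro _ ⟨ω, hω, -, rfl⟩
    exact ⟨⟨ω, hω⟩, rfl⟩
  let b := Module.Basis.mk (linearIndependent_normalProd hn hlift h0 hg) hspan
  have hb : ∀ ω, b ω = normalProd g (normalForm ω.1) := fun ω => by
    rw [Module.Basis.mk_apply]
  refine ⟨b, hb, ?_⟩
  set ω₀ : {ω : SignedPerm n // Avoids ω} := ⟨fullPerm n, avoids_fullPerm⟩ with hω₀
  -- This part of the filtration is spanned by basis elements with fewer than n negative values, and
  -- `ω₀` has n.
  have hlow : ∀ x ∈ D.filt n, b.repr x ω₀ = 0 := by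
    have hker : D.filt n ≤ LinearMap.ker (b.coord ω₀) := by
      refine (FusedData.filt_le_span hlet n).trans (Submodule.span_le.mpr ?_)
      rintro _ ⟨ω, h1, h2, rfl⟩
      have hne : (⟨ω, h1⟩ : {ω : SignedPerm n // Avoids ω}) ≠ ω₀ := by
        intro e
        have e' : ω = fullPerm n := congrArg Subtype.val e
        rw [e', negCount_fullPerm] at h2
        exact lt_irrefl _ h2
      change b.coord ω₀ _ = 0
      rw [← hb ⟨ω, h1⟩, Module.Basis.coord_apply, Module.Basis.repr_self,
        Finsupp.single_eq_of_ne' hne]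
    exact fun x hx => hker hx
  have hrepr : ∀ ω : SignedPerm n, (∏ i : Fin n, ((i : ℂ) - κ₂) ^ (1 - mult ω i)) *
      b.repr (normalProd g (normalForm ω)) ω₀
        = if ∀ m, (normalForm ω m).1 = true then 1 else 0 := by
    intro ω
    have hcount := FusedData.negCount_eq_trueCount hlet ω
    have hiff := trueCount_eq_iff (normalForm ω) n le_rfl
    split_ifs with h
    · rw [← hcount] at hiff
      have h1 := hlow _ (FusedData.normalProd_sub_mem hlet (hiff.mpr fun m _ => h m))
      have e0 : normalProd g (normalForm (fullPerm n)) = b ω₀ := (hb ω₀).symm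
      rw [map_sub, Finsupp.sub_apply, sub_eq_zero, e0, Module.Basis.repr_self,
        Finsupp.single_eq_same] at h1
      rw [h1, mul_one]
      -- All exponents are 0, so each factor is 1 even when κ₂ = i, by 0⁰ = 1.
      refine Finset.prod_eq_one fun i _ => ?_
      simp [mult, h]
    · have h1 : trueCount (normalForm ω) n le_rfl < n := by
        refine lt_of_le_of_ne (trueCount_le _ _ _) fun e => h fun m => hiff.mp e m m.2
      rw [hlow _ (FusedData.filt_mono h1 (FusedData.hasLeading_normalProd hlet ω).mem_filt),
        mul_zero]
  rw [map_sum, Finsupp.finsetSum_apply]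
  simp only [map_smul, Finsupp.smul_apply, smul_eq_mul, hrepr]
  rw [← sum_all_true]
  exact Equiv.sum_comp normalForm fun c : NormalForm n => if ∀ m, (c m).1 = true then (1 : ℂ) else 0

end Basis

end FusedHecke

theorem mainTheorem10 (n : ℕ) (hn : 1 ≤ n) (κ₁ κ₂ : ℂ) :
    ∃ b : Module.Basis {ω : FusedHecke.SignedPerm n // FusedHecke.Avoids ω} ℂ
        (FusedHecke.QuotAlg n κ₁ κ₂),
      (∀ ω, b ω = FusedHecke.toQuot n κ₁ κ₂ (FusedHecke.sElt n κ₁ κ₂ ω.1)) ∧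
      ∃ ω₀ : {ω : FusedHecke.SignedPerm n // FusedHecke.Avoids ω},
        b ω₀ = FusedHecke.toQuot n κ₁ κ₂
          (FusedHecke.Delta n κ₁ κ₂ (n - 1) (Nat.sub_one_lt_of_lt hn)) ∧
        b.repr (FusedHecke.toQuot n κ₁ κ₂ (FusedHecke.Ftilde n κ₁ κ₂)) ω₀ = (n ! : ℂ) := by
  let g : Fin n → FusedHecke.QuotAlg n κ₁ κ₂ := fun i =>
    FusedHecke.toQuot n κ₁ κ₂ (FusedHecke.letter n κ₁ κ₂ i)
  have h0 : g ⟨0, hn⟩ = FusedHecke.quotX n κ₁ κ₂ ⟨0, hn⟩ := rfl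
  have hg : ∀ i : Fin n, (i : ℕ) ≠ 0 → g i = FusedHecke.quotS n κ₁ κ₂ i := fun i hi => by
    have h : 1 ≤ (i : ℕ) ∧ (i : ℕ) < n := ⟨by omega, i.2⟩
    rw [FusedHecke.quotS_of_lt _ _ h]
    simp only [g, FusedHecke.letter, hi, dite_false]
  have hmap : ∀ c, FusedHecke.toQuot n κ₁ κ₂ (FusedHecke.normalProd (FusedHecke.letter n κ₁ κ₂) c)
      = FusedHecke.normalProd g c := fun c =>
    FusedHecke.map_normalProd (FusedHecke.toQuot n κ₁ κ₂) _ c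
  obtain ⟨b, hb, hcoef⟩ := (FusedHecke.quotRel κ₁ κ₂ (n := n)).exists_basis hn
    (FusedHecke.quot_submodule_eq_top κ₁ κ₂)
    (FusedHecke.letterData n (κ₂ - κ₁ - 1)).rel.exists_lift h0 hg
  refine ⟨b, fun ω => (hb ω).trans (hmap _).symm,
    ⟨FusedHecke.fullPerm n, FusedHecke.avoids_fullPerm⟩, ?_, ?_⟩
  · rw [hb, ← hmap]
    congr 1
    have e : FusedHecke.normalForm (FusedHecke.fullPerm n) = FusedHecke.fullForm n :=
      FusedHecke.normalForm.apply_symm_apply _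
    obtain ⟨p, rfl⟩ : ∃ p, n = p + 1 := ⟨n - 1, by omega⟩
    simp only [e]
    exact FusedHecke.partialProd_fullForm _ (p + 1) le_rfl
  · rw [← hcoef]
    congr 2
    rw [FusedHecke.Ftilde, map_sum]
    refine Finset.sum_congr rfl fun ω _ => ?_
    rw [map_smul, FusedHecke.sElt, hmap]
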